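/- Let $\mathbb K$ be a field of characteristic zero and $\mathfrak g$ a finite-dimensional Lie algebra over $\mathbb K$. Write $S(\mathfrak g)$ for the symmetric algebra of $\mathfrak g$ (polynomials on $\mathfrak g^*$) with the Lie--Poisson bracket, the biderivation with $\{\xi,\eta\}=[\xi,\eta]$ for $\xi,\eta\in\mathfrak g$, which extends to $\operatorname{Frac}S(\mathfrak g)$. Let $\operatorname{ind}\mathfrak g$ be the corank of the form $(\xi,\eta)\mapsto\langle x,[\xi,\eta]\rangle$ for generic $x\in\mathfrak g^*$. A subalgebra $\mathcal A\subset S(\mathfrak g)$ is called complete commutative if $\{\mathcal A,\mathcal A\}=0$ and $\operatorname{tr.deg}\mathcal A=\frac12(\dim\mathfrak g+\operatorname{ind}\mathfrak g)$. Let $\mathfrak h_m\subset\mathfrak g$ be an ideal that is a Heisenberg algebra: $\mathfrak h_m=V\oplus\mathbb K e$ with $e\neq 0$ central in $\mathfrak h_m$, $\dim V=2m$, and $[v,w]=\omega(v,w)e$ for $v,w\in V$, where $\omega$ is a symplectic form on $V$. Assume that the center of $\mathfrak h_m$ equals the center $Z(\mathfrak g)$ of $\mathfrak g$. Let $\mathfrak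 b=\{\xi\in\mathfrak g : [\xi,V]\subset V\}$, a subalgebra of $\mathfrak g$ containing $e$. Let $\operatorname{Ann}(\mathfrak h_m)=\{f\in S(\mathfrak g):\{f,\eta\}=0\ \forall\eta\in\mathfrak h_m\}$ and $\operatorname{Ann}_{\rm frac}(\mathfrak h_m)=\{f/s: f\in\operatorname{Ann}(\mathfrak h_m),\ 0\ne s\in S(Z(\mathfrak g))\}$. For $\beta\in\mathfrak b$ put $$f_\beta(x)=\langle\beta,x\rangle\langle e,x\rangle+\tfrac12\langle\omega^{-1}(\operatorname{ad}_\beta^*\pi(x)),x\rangle ,\qquad \tilde f_\beta=f_\beta/e ,$$ where $\pi:\mathfrak g^*\to V^*$ is the restriction, $\operatorname{ad}_\beta^*p=-p\circ\operatorname{ad}_\beta|_V$, and $\omega(\omega^{-1}(p),\cdot)=p$. Let $f\mapsto\tilde f$ be the algebra homomorphism $S(\mathfrak b)\to\operatorname{Frac}S(\mathfrak g)$ that extends $\beta\mapsto\tilde f_\beta$. Then: 1. If $S(\mathfrak b)$ has a complete commutative subalgebra, then so does $S(\mathfrak g)$. 2. The map $f\mapsto\tilde f$ is injective, preserves Poisson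 brackets, and takes values in $\operatorname{Ann}_{\rm frac}(\mathfrak h_m)$. 3. Let $\mathcal A\subset S(\mathfrak b)$ be a complete commutative subalgebra, let $\tilde{\mathcal A}$ be the image under $f\mapsto\tilde f$ of the subalgebra generated by $\mathcal A$ and $e$, and let $\tilde{\mathcal A}_{\rm pol}=\tilde{\mathcal A}\cap S(\mathfrak g)$. Then $\tilde{\mathcal A}_{\rm pol}\subset\operatorname{Ann}(\mathfrak h_m)$, and for every complete commutative subalgebra $\mathcal B\subset S(\mathfrak h_m)$ the subalgebra of $S(\mathfrak g)$ generated by $\tilde{\mathcal A}_{\rm pol}$ and $\mathcal B$ is complete commutative in $S(\mathfrak g)$. -/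

import Mathlib

open Module

noncomputable section

namespace MF

/-! ### Derivations on symmetric algebras and on their fraction fields -/

section Derivations

variable {K : Type*} [Field K]

/-- An algebra homomorphism `a ↦ a + ε D(a)` into the dual numbers over `B` that lifts the
structure map `A → B` is the same thing as a derivation `D : A → B`. -/
def derivationOfLift {A B : Type*} [CommRing A] [CommRing B] [Algebra K A] [Algebra K B]
    [Algebra A B] (φ : A →ₐ[K] TrivSqZeroExt B B)
    (hφ : ∀ a, (φ a).fst = algebraMap A B a) : Derivation K A B :=
  Derivation.mk' ((TrivSqZeroExt.sndHom B B).restrictScalars K ∘ₗ φ.toLinearMap) (by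
    intro a b
    simp [hφ, Algebra.smul_def, mul_comm])

variable {W : Type*} [AddCommGroup W] [Module K W]

/-- The homomorphism `S(W) → B[ε]` with `w ↦ w + ε φ(w)`. -/
def symLift {B : Type*} [CommRing B] [Algebra K B] [Algebra (SymmetricAlgebra K W) B]
    [IsScalarTower K (SymmetricAlgebra K W) B] (φ : W →ₗ[K] B) :
    SymmetricAlgebra K W →ₐ[K] TrivSqZeroExt B B :=
  SymmetricAlgebra.lift
    ((TrivSqZeroExt.inlAlgHom K B B).toLinearMap ∘ₗ
        (IsScalarTower.toAlgHom K (SymmetricAlgebra K W) B).toLinearMap ∘ₗ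
          SymmetricAlgebra.ι K W
      + (TrivSqZeroExt.inrHom B B).restrictScalars K ∘ₗ φ)

theorem symLift_fst {B : Type*} [CommRing B] [Algebra K B] [Algebra (SymmetricAlgebra K W) B]
    [IsScalarTower K (SymmetricAlgebra K W) B] (φ : W →ₗ[K] B) (f : SymmetricAlgebra K W) :
    (symLift φ f).fst = algebraMap (SymmetricAlgebra K W) B f := by
  have : (TrivSqZeroExt.fstHom K B B).comp (symLift φ) =
      IsScalarTower.toAlgHom K (SymmetricAlgebra K W) B := by
    apply SymmetricAlgebra.algHom_ext
    ext w
    simp [symLift]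
  exact congrArg (fun F => F f) this

/-- The unique `K`-derivation `S(W) → B` that extends a linear map `φ : W → B`. -/
def symDer {B : Type*} [CommRing B] [Algebra K B] [Algebra (SymmetricAlgebra K W) B]
    [IsScalarTower K (SymmetricAlgebra K W) B] (φ : W →ₗ[K] B) :
    Derivation K (SymmetricAlgebra K W) B :=
  derivationOfLift (symLift φ) (symLift_fst φ)

theorem symDer_ι {B : Type*} [CommRing B] [Algebra K B] [Algebra (SymmetricAlgebra K W) B]
    [IsScalarTower K (SymmetricAlgebra K W) B] (φ : W →ₗ[K] B) (w : W) :
    symDer φ (SymmetricAlgebra.ι K W w) = φ w := by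
  simp [symDer, derivationOfLift, symLift]

theorem symDer_ext {B : Type*} [CommRing B] [Algebra K B] [Algebra (SymmetricAlgebra K W) B]
    [IsScalarTower K (SymmetricAlgebra K W) B] {D E : Derivation K (SymmetricAlgebra K W) B}
    (h : ∀ w, D (SymmetricAlgebra.ι K W w) = E (SymmetricAlgebra.ι K W w)) : D = E := by
  ext f
  induction f using SymmetricAlgebra.induction with
  | algebraMap r => simp
  | ι x => exact h x
  | mul a b ha hb => simp [ha, hb]
  | add a b ha hb => simp [ha, hb]

variable {S : Type*} [CommRing S] [IsDomain S] [Algebra K S]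

/-- The homomorphism `Frac S → (Frac S)[ε]` with `s ↦ s + ε D(s)` on `S`. -/
def fracLift (D : Derivation K S (FractionRing S)) :
    FractionRing S →ₐ[K] TrivSqZeroExt (FractionRing S) (FractionRing S) :=
  IsLocalization.liftAlgHom (M := nonZeroDivisors S)
    (f := AlgHom.ofLinearMap
      ((TrivSqZeroExt.inlAlgHom K (FractionRing S) (FractionRing S)).toLinearMap ∘ₗ
          (IsScalarTower.toAlgHom K S (FractionRing S)).toLinearMap
        + (TrivSqZeroExt.inrHom (FractionRing S) (FractionRing S)).restrictScalars K ∘ₗ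
          (D : S →ₗ[K] FractionRing S))
      (by ext <;> simp)
      (by
        intro a b
        ext
        · simp
        · have hD : D (a * b) = algebraMap S (FractionRing S) a * D b +
              algebraMap S (FractionRing S) b * D a := by
            rw [D.leibniz, Algebra.smul_def, Algebra.smul_def]
          simp [hD, mul_comm]))
    (by
      intro y
      rw [TrivSqZeroExt.isUnit_iff_isUnit_fst]
      simp)

theorem fracLift_fst (D : Derivation K S (FractionRing S)) (F : FractionRing S) :
    (fracLift D F).fst = algebraMap (FractionRing S) (FractionRing S) F := by
  have : (TrivSqZeroExt.fstHom K (FractionRing S) (FractionRing S)).comp (fracLift D) =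
      AlgHom.id K (FractionRing S) := by
    apply IsLocalization.algHom_ext (nonZeroDivisors S)
    ext s
    simp [fracLift, Algebra.algHom]
  exact congrArg (fun G => G F) this

/-- The unique extension of a derivation `S → Frac S` to the fraction field of `S`. -/
def fracDer (D : Derivation K S (FractionRing S)) :
    Derivation K (FractionRing S) (FractionRing S) :=
  derivationOfLift (fracLift D) (fracLift_fst D)

theorem fracDer_algebraMap (D : Derivation K S (FractionRing S)) (s : S) :
    fracDer D (algebraMap S (FractionRing S) s) = D s := by
  simp [fracDer, derivationOfLift, fracLift]

theorem fracDer_ext {D E : Derivation K (FractionRing S) (FractionRing S)}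
    (h : ∀ s : S, D (algebraMap S (FractionRing S) s) = E (algebraMap S (FractionRing S) s)) :
    D = E := by
  ext F
  obtain ⟨a, b, hb, rfl⟩ := IsFractionRing.div_surjective (A := S) F
  simp [Derivation.leibniz_div, h]

end Derivations

/-! ### The Lie-Poisson bracket -/

section Poisson

variable (K : Type*) [Field K] (g : Type*) [LieRing g] [LieAlgebra K g]

/-- The commutator of `g` as a bilinear map. -/
def lieMap : g →ₗ[K] g →ₗ[K] g :=
  LinearMap.mk₂ K (fun ξ η => ⁅ξ, η⁆) (fun _ _ _ => add_lie _ _ _) (fun _ _ _ => smul_lie _ _ _)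
    (fun _ _ _ => lie_add _ _ _) (fun _ _ _ => lie_smul _ _ _)

/-- For `ξ ∈ g`, the derivation `{ξ, ·}` of `S(g)`: it sends `η ∈ g` to `[ξ, η]`. -/
def hamiltonian : g →ₗ[K] Derivation K (SymmetricAlgebra K g) (SymmetricAlgebra K g) where
  toFun ξ := symDer (SymmetricAlgebra.ι K g ∘ₗ lieMap K g ξ)
  map_add' ξ η := symDer_ext fun w => by simp [symDer_ι]
  map_smul' c ξ := symDer_ext fun w => by simp [symDer_ι]

/-- For `ξ ∈ g`, the derivation `{ξ, ·}` of `Frac S(g)`: it sends `η ∈ g` to `[ξ, η]`. -/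
def fracHamiltonian : g →ₗ[K]
    Derivation K (FractionRing (SymmetricAlgebra K g)) (FractionRing (SymmetricAlgebra K g)) where
  toFun ξ := fracDer ((Algebra.linearMap (SymmetricAlgebra K g)
    (FractionRing (SymmetricAlgebra K g))).compDer (hamiltonian K g ξ))
  map_add' ξ η := fracDer_ext fun s => by simp [fracDer_algebraMap]
  map_smul' c ξ := fracDer_ext fun s => by
    simp [fracDer_algebraMap, Algebra.smul_def]

variable {K g}

/-- The Lie-Poisson bracket on `S(g)`: a derivation in each argument, and equal to the
commutator of `g` on `g`. -/
def poissonBracket (f₁ f₂ : SymmetricAlgebra K g) : SymmetricAlgebra K g :=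
  symDer (B := SymmetricAlgebra K g)
    { toFun := fun ξ => hamiltonian K g ξ f₂
      map_add' := fun ξ η => by rw [map_add, Derivation.add_apply]
      map_smul' := fun c ξ => by rw [map_smul, Derivation.smul_apply, RingHom.id_apply] } f₁

/-- The Lie-Poisson bracket on `Frac S(g)`: the biderivation extending the one of `S(g)`. -/
def fracPoissonBracket (F₁ F₂ : FractionRing (SymmetricAlgebra K g)) :
    FractionRing (SymmetricAlgebra K g) :=
  fracDer (symDer (B := FractionRing (SymmetricAlgebra K g))
    { toFun := fun ξ => fracHamiltonian K g ξ F₂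
      map_add' := fun ξ η => by rw [map_add, Derivation.add_apply]
      map_smul' := fun c ξ => by rw [map_smul, Derivation.smul_apply, RingHom.id_apply] }) F₁

theorem poissonBracket_ι_ι (ξ η : g) :
    poissonBracket (SymmetricAlgebra.ι K g ξ) (SymmetricAlgebra.ι K g η) =
      SymmetricAlgebra.ι K g ⁅ξ, η⁆ := by
  simp [poissonBracket, hamiltonian, symDer_ι, lieMap]

variable (K g)

/-- The skew-symmetric form `Φ_x(ξ, η) = ⟨x, [ξ, η]⟩` on `g`, for `x ∈ g*`. -/
def lieForm (x : Dual K g) : LinearMap.BilinForm K g :=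
  (lieMap K g).compr₂ x

/-- The index of `g`: the corank of `Φ_x` for generic `x`, i.e. the smallest corank. -/
def index : ℕ := ⨅ x : Dual K g, finrank K (LinearMap.ker (lieForm K g x))

variable {K g}

/-- A subalgebra of `S(g)` is commutative if the Poisson bracket vanishes on it, and complete
if moreover its transcendence degree is `(dim g + ind g) / 2`. -/
def IsCompleteCommutative (A : Subalgebra K (SymmetricAlgebra K g)) : Prop :=
  (∀ f₁ ∈ A, ∀ f₂ ∈ A, poissonBracket f₁ f₂ = 0) ∧
    2 * Algebra.trdeg K A = ((finrank K g + index K g : ℕ) : Cardinal)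

/-- `Ann(h)`, the polynomials in `S(g)` that Poisson-commute with `h`. -/
def ann (h : LieIdeal K g) : Subalgebra K (SymmetricAlgebra K g) where
  carrier := {f | ∀ η ∈ h, poissonBracket f (SymmetricAlgebra.ι K g η) = 0}
  mul_mem' := by
    intro a b ha hb η hη
    have h1 := ha η hη
    have h2 := hb η hη
    simp only [poissonBracket] at h1 h2 ⊢
    simp [h1, h2]
  add_mem' := by
    intro a b ha hb η hη
    have h1 := ha η hη
    have h2 := hb η hη
    simp only [poissonBracket] at h1 h2 ⊢
    simp [h1, h2]
  algebraMap_mem' := by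
    intro r η _
    simp [poissonBracket]

variable (K g) in
/-- `S(Z(g))` inside `S(g)`. -/
def centerPolynomials : Subalgebra K (SymmetricAlgebra K g) :=
  Algebra.adjoin K (SymmetricAlgebra.ι K g '' (LieAlgebra.center K g : Set g))

/-- `Ann_frac(h)`, the fractions `f / s` with `f ∈ Ann(h)` and `0 ≠ s ∈ S(Z(g))`. -/
def annFrac (h : LieIdeal K g) : Set (FractionRing (SymmetricAlgebra K g)) :=
  {F | ∃ f ∈ ann h, ∃ s ∈ centerPolynomials K g, s ≠ 0 ∧
    F = algebraMap _ (FractionRing (SymmetricAlgebra K g)) f /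
      algebraMap _ (FractionRing (SymmetricAlgebra K g)) s}

/-- The inclusion `S(h) → S(g)` induced by `h ⊆ g`. -/
def symInclusion (h : LieIdeal K g) : SymmetricAlgebra K h →ₐ[K] SymmetricAlgebra K g :=
  SymmetricAlgebra.lift (SymmetricAlgebra.ι K g ∘ₗ h.toSubmodule.subtype)

end Poisson

/-! ### Heisenberg ideals -/

section Heisenberg

variable {K : Type*} [Field K] {g : Type*} [LieRing g] [LieAlgebra K g]

/-- The ideal `h` is a Heisenberg algebra `h_m`, with a chosen splitting: `h = V ⊕ K e` with
`dim V = 2m`, `e` central in `h`, and `[v, w] = ω(v, w) e` on `V` for a symplectic form `ω`. -/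
structure HeisenbergSplitting (h : LieIdeal K g) (m : ℕ) where
  V : Submodule K g
  e : g
  ω : LinearMap.BilinForm K V
  e_ne_zero : e ≠ 0
  disjoint : Disjoint V (Submodule.span K {e})
  sup_eq : V ⊔ Submodule.span K {e} = h.toSubmodule
  finrank_V : finrank K V = 2 * m
  alt : ω.IsAlt
  nondegenerate : ω.Nondegenerate
  lie_V : ∀ v w : V, ⁅(v : g), (w : g)⁆ = ω v w • e
  lie_e : ∀ v : V, ⁅e, (v : g)⁆ = 0

namespace HeisenbergSplitting

variable {h : LieIdeal K g} {m : ℕ} (D : HeisenbergSplitting h m)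

/-- The subalgebra `b = {ξ ∈ g | [ξ, V] ⊆ V}`. -/
def b : LieSubalgebra K g where
  carrier := {ξ | ∀ v ∈ D.V, ⁅ξ, v⁆ ∈ D.V}
  add_mem' := by
    intro x y hx hy v hv
    rw [add_lie]
    exact D.V.add_mem (hx v hv) (hy v hv)
  zero_mem' := by
    intro v _
    simp
  smul_mem' := by
    intro c x hx v hv
    rw [smul_lie]
    exact D.V.smul_mem c (hx v hv)
  lie_mem' := by
    intro x y hx hy v hv
    rw [lie_lie]
    exact D.V.sub_mem (hx _ (hy v hv)) (hy _ (hx v hv))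

theorem e_mem_b : D.e ∈ D.b := by
  intro v hv
  rw [D.lie_e ⟨v, hv⟩]
  exact D.V.zero_mem

variable [FiniteDimensional K g]

/-- The quadratic polynomial `x ↦ ⟨ω⁻¹((ad_β)* π(x)), x⟩` on `g*`. Here `π : g* → V*` is the
restriction, `(ad_β)* p = - p ∘ ad_β` is the dual representation on `V*`, and
`ω⁻¹(p) = ∑ p(v_i) w_i` where `ω(w_i, v_j) = δ_ij`, i.e. `ω(ω⁻¹(p), ·) = p`. -/
def quad : D.b →ₗ[K] SymmetricAlgebra K g :=
  -∑ i, LinearMap.mulRight K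
      (SymmetricAlgebra.ι K g (D.ω.dualBasis D.nondegenerate (finBasis K D.V) i : D.V)) ∘ₗ
    SymmetricAlgebra.ι K g ∘ₗ
      (lieMap K g).flip (finBasis K D.V i : D.V) ∘ₗ
        D.b.toSubmodule.subtype

/-- `f_β = β e + (1/2) ⟨ω⁻¹((ad_β)* π(x)), x⟩`, a quadratic polynomial in `Ann(h)`. -/
def fPoly : D.b →ₗ[K] SymmetricAlgebra K g :=
  LinearMap.mulRight K (SymmetricAlgebra.ι K g D.e) ∘ₗ
      SymmetricAlgebra.ι K g ∘ₗ D.b.toSubmodule.subtype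
    + (2⁻¹ : K) • D.quad

/-- The homomorphism `f ↦ f̃` from `S(b)` to `Frac S(g)`, generated by `β ↦ f̃_β = f_β / e`. -/
def tilde : SymmetricAlgebra K D.b →ₐ[K] FractionRing (SymmetricAlgebra K g) :=
  SymmetricAlgebra.lift
    (LinearMap.mulRight K
        (algebraMap _ (FractionRing (SymmetricAlgebra K g)) (SymmetricAlgebra.ι K g D.e))⁻¹ ∘ₗ
      (IsScalarTower.toAlgHom K (SymmetricAlgebra K g)
        (FractionRing (SymmetricAlgebra K g))).toLinearMap ∘ₗ D.fPoly)

/-- For a subalgebra `A` of `S(b)`, enlarged by the polynomials in the central element `e`, the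
polynomial part `Ã ∩ S(g)` of its image `Ã` under `f ↦ f̃`. -/
def polynomialPart (A : Subalgebra K (SymmetricAlgebra K D.b)) :
    Subalgebra K (SymmetricAlgebra K g) :=
  ((A ⊔ Algebra.adjoin K {SymmetricAlgebra.ι K D.b ⟨D.e, D.e_mem_b⟩}).map D.tilde).comap
    (IsScalarTower.toAlgHom K (SymmetricAlgebra K g) (FractionRing (SymmetricAlgebra K g)))

end HeisenbergSplitting

end Heisenberg

end MF

end

/-! Everything is measured by differentials. In characteristic zero the transcendence degree of a
subalgebra of a function field is the dimension of the span of its differentials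
(`trdeg_eq_finrank_span`), and the Poisson bracket of two functions is a bilinear form evaluated on
their gradients. A commutative algebra therefore gives an isotropic subspace, whence the upper bound
`two_mul_trdeg_le`; completeness only requires the opposite inequality.

The hypothesis on centers makes `e` central in `g`, so `b` acts on `V` by symplectic maps. The
quadratic term in `f_β` is the corresponding moment map: it is equivariant under `b`, and its
bracket with `V` cancels that of `βe`. Hence `f̃_β` commutes with `h`, and as `f̃_β - β` is a
rational function of elements of `h`, `{f̃_β, f̃_γ} = {β, f̃_γ} = f̃_[β,γ]`. Setting `V` to zero
recovers `f` from `f̃`, which gives injectivity.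

For completeness, the differentials of the `f̃_β` and of `h` together span a space of dimension `dim
g = dim b + 2m`, so the two spans, of dimensions at most `dim b` and `2m + 1`, share at most one
direction. Thus at most one is lost from `trdeg A + trdeg B` (`trdeg_add_le`). With `ind g ≤ ind b`
(`index_le_index_b`) and `1 ≤ ind h`, the count reaches `(dim g + ind g) / 2`. A Lagrangian subspace
of `V` together with `e` supplies a complete algebra on `h`, so the first claim follows from the
third. -/

open Module

noncomputable section

namespace MF

/-! ### Derivations and transcendence degree: the Jacobian criterion. -/

section Jacobian

variable {K F M : Type*} [Field K] [Field F] [Algebra K F] [AddCommGroup M] [Module F M]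
  [Module K M] [IsScalarTower K F M]

/-- A derivation that kills an intermediate field is linear over it. -/
def derivationOfKills (d : Derivation K F M) (L : IntermediateField K F) (h : ∀ x ∈ L, d x = 0) :
    Derivation L F M :=
  Derivation.mk'
    { toFun := d
      map_add' := map_add d
      map_smul' := fun l x => by
        rw [Algebra.smul_def, d.leibniz]
        change l.1 • d x + x • d l.1 = l.1 • d x
        rw [h l.1 l.2, smul_zero, add_zero] }
    fun a b => d.leibniz a b

omit [IsScalarTower K F M] in
-- Differentiate the minimal polynomial of `x`: by separability its derivative does not vanish at
-- `x`.
theorem derivation_eq_zero_of_isAlgebraic [CharZero K] (d : Derivation K F M)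
    (L : IntermediateField K F) (h : ∀ x ∈ L, d x = 0) {x : F} (hx : IsAlgebraic L x) :
    d x = 0 := by
  have : CharZero L := charZero_of_injective_algebraMap (algebraMap K L).injective
  have hsep : (minpoly L x).Separable := (minpoly.irreducible hx.isIntegral).separable
  have h1 := (derivationOfKills d L h).map_aeval (minpoly L x) x
  rw [minpoly.aeval, map_zero] at h1
  exact ((smul_eq_zero.mp h1.symm).resolve_left
    (hsep.aeval_derivative_ne_zero (minpoly.aeval L x)))

theorem derivation_mem_span_of_isAlgebraic [CharZero K] (d : Derivation K F M) (s : Set F) {x : F}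
    (hx : IsAlgebraic (IntermediateField.adjoin K s) x) : d x ∈ Submodule.span F (d '' s) := by
  set N := Submodule.span F (d '' s)
  -- Modulo the span of `d s` the derivation vanishes on `K(s)`, so the preceding lemma applies to
  -- it.
  let d' : Derivation K F (M ⧸ N) := N.mkQ.compDer d
  have hd' : ∀ y, d' y = N.mkQ (d y) := fun _ => rfl
  have h0 : ∀ y ∈ IntermediateField.adjoin K s, d' y = 0 := by
    intro y hy
    induction hy using IntermediateField.adjoin_induction with
    | mem y hy =>
      rw [hd', Submodule.mkQ_apply, Submodule.Quotient.mk_eq_zero]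
      exact Submodule.subset_span ⟨y, hy, rfl⟩
    | algebraMap r => exact d'.map_algebraMap r
    | add a b _ _ ha hb => rw [map_add, ha, hb, add_zero]
    | inv a _ ha => rw [d'.leibniz_inv, ha, smul_zero]
    | mul a b _ _ ha hb => rw [d'.leibniz, ha, hb, smul_zero, smul_zero, add_zero]
  have := derivation_eq_zero_of_isAlgebraic d' _ h0 hx
  rwa [hd', Submodule.mkQ_apply, Submodule.Quotient.mk_eq_zero] at this

/-- Extend `s` to a transcendence basis `t`. All of `F` is algebraic over `K(t)`, so `d t` spans
`M`; its cardinality is `dim M`, so it is independent. -/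
theorem linearIndepOn_of_algebraicIndepOn [CharZero K] [FiniteDimensional F M]
    (d : Derivation K F M) (hspan : Submodule.span F (Set.range d) = ⊤)
    (htr : Algebra.trdeg K F = (finrank F M : Cardinal)) {s : Set F}
    (hs : AlgebraicIndepOn K id s) : LinearIndepOn F d s := by
  obtain ⟨t, hst, ht⟩ := exists_isTranscendenceBasis_superset hs
  have hcard : Cardinal.mk t = finrank F M := by rw [← htr]; exact ht.cardinalMk_eq_trdeg
  have hfin : Finite t := by
    rw [← Cardinal.lt_aleph0_iff_finite, hcard]
    exact Cardinal.natCast_lt_aleph0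
  have := Fintype.ofFinite t
  refine LinearIndepOn.mono ?_ hst
  refine linearIndependent_of_top_le_span_of_card_eq_finrank ?_ ?_
  · rw [← hspan, Submodule.span_le]
    rintro _ ⟨x, rfl⟩
    have halg := ht.isAlgebraic_field
    rw [Subtype.range_val] at halg
    have := derivation_mem_span_of_isAlgebraic d t (halg.isAlgebraic x)
    rwa [Set.image_eq_range] at this
  · rw [← Nat.cast_inj (R := Cardinal), ← hcard, Cardinal.mk_fintype]

/-- Jacobian criterion: the transcendence degree of a subalgebra is the dimension of the span of
its differentials. -/
theorem trdeg_eq_finrank_span [CharZero K] [FiniteDimensional F M]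
    (d : Derivation K F M) (hspan : Submodule.span F (Set.range d) = ⊤)
    (htr : Algebra.trdeg K F = (finrank F M : Cardinal)) (A : Subalgebra K F) :
    Algebra.trdeg K A = (finrank F (Submodule.span F (d '' A)) : Cardinal) := by
  obtain ⟨t, ht⟩ := exists_isTranscendenceBasis K A
  have hind : AlgebraicIndepOn K id (Subtype.val '' t : Set F) := by
    have h1 : AlgebraicIndependent K (fun x : t => (x.1.1 : F)) :=
      ht.1.map' (f := A.val) Subtype.val_injective
    have := h1.to_subtype_range
    rwa [← Set.image_eq_range (fun x : A => (x : F)) t] at this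
  have hli := linearIndepOn_of_algebraicIndepOn d hspan htr hind
  have heq : Submodule.span F (d '' A) = Submodule.span F (d '' (Subtype.val '' t)) := by
    apply le_antisymm
    · rw [Submodule.span_le]
      rintro _ ⟨x, hx, rfl⟩
      refine derivation_mem_span_of_isAlgebraic d _ ?_
      have h2 := ht.isAlgebraic.isAlgebraic ⟨x, hx⟩
      rw [Subtype.range_val] at h2
      have hle : ∀ y ∈ Algebra.adjoin K t,
          (y : F) ∈ IntermediateField.adjoin K (Subtype.val '' t : Set F) := by
        intro y hy
        induction hy using Algebra.adjoin_induction with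
        | mem y hy => exact IntermediateField.subset_adjoin _ _ ⟨y, hy, rfl⟩
        | algebraMap r => exact IntermediateField.algebraMap_mem _ r
        | add a b _ _ ha hb => exact add_mem ha hb
        | mul a b _ _ ha hb => exact mul_mem ha hb
      -- Algebraicity is known over `K[t]` inside `A`; this embedding transfers it to the field
      -- `K(t)` inside `F`.
      let φ : Algebra.adjoin K t →+* IntermediateField.adjoin K (Subtype.val '' t : Set F) :=
        (A.val.toRingHom.comp (Algebra.adjoin K t).val.toRingHom).codRestrict
          (IntermediateField.adjoin K (Subtype.val '' t : Set F)) fun y => hle y.1 y.2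
      let _ : Algebra (Algebra.adjoin K t)
        (IntermediateField.adjoin K (Subtype.val '' t : Set F)) := φ.toAlgebra
      have : IsScalarTower (Algebra.adjoin K t)
        (IntermediateField.adjoin K (Subtype.val '' t : Set F)) F :=
        IsScalarTower.of_algebraMap_eq fun _ => rfl
      have h3 : IsAlgebraic (Algebra.adjoin K t) x := h2.algebraMap (A := F)
      refine h3.extendScalars (fun a b hab => ?_)
      have := congrArg Subtype.val hab
      exact Subtype.ext (Subtype.ext this)
    · apply Submodule.span_mono
      rintro _ ⟨_, ⟨x, -, rfl⟩, rfl⟩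
      exact ⟨x, x.2, rfl⟩
  rw [heq, ← ht.cardinalMk_eq_trdeg, Set.image_eq_range]
  have hfin : Finite (Subtype.val '' t : Set F) := LinearIndependent.finite hli
  have := Fintype.ofFinite (Subtype.val '' t : Set F)
  rw [finrank_span_eq_card hli, ← Cardinal.mk_fintype, Cardinal.mk_image_eq Subtype.val_injective]

end Jacobian

/-! ### Gradients of rational functions on the dual space. -/

section Gradient

variable {K : Type*} [Field K] {W : Type*} [AddCommGroup W] [Module K W]

theorem frac_derivation_ext {M : Type*} [AddCommGroup M] [Module K M]
    [Module (FractionRing (SymmetricAlgebra K W)) M]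
    {D E : Derivation K (FractionRing (SymmetricAlgebra K W)) M}
    (h : ∀ w, D (algebraMap _ _ (SymmetricAlgebra.ι K W w)) =
      E (algebraMap _ _ (SymmetricAlgebra.ι K W w))) : D = E := by
  have hs : ∀ s : SymmetricAlgebra K W, D (algebraMap _ _ s) = E (algebraMap _ _ s) := by
    intro s
    induction s using SymmetricAlgebra.induction with
    | algebraMap r =>
      rw [← IsScalarTower.algebraMap_apply, D.map_algebraMap, E.map_algebraMap]
    | ι x => exact h x
    | mul a b ha hb => rw [map_mul, D.leibniz, E.leibniz, ha, hb]
    | add a b ha hb => rw [map_add, map_add, map_add, ha, hb]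
  ext F
  obtain ⟨a, b, hb, rfl⟩ := IsFractionRing.div_surjective (A := SymmetricAlgebra K W) F
  rw [D.leibniz_div, E.leibniz_div, hs, hs]

variable [FiniteDimensional K W]

variable (K W) in
/-- The partial derivatives of a rational function with respect to a basis of `W`. -/
def grad : Derivation K (FractionRing (SymmetricAlgebra K W))
    (Fin (finrank K W) → FractionRing (SymmetricAlgebra K W)) :=
  Derivation.mk'
    (LinearMap.pi fun i => (fracDer (symDer (B := FractionRing (SymmetricAlgebra K W))
      (Algebra.linearMap K _ ∘ₗ (finBasis K W).coord i)) : _ →ₗ[K] _))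
    fun a b => by
      ext i
      simp

theorem grad_ι (w : W) (i : Fin (finrank K W)) :
    grad K W (algebraMap _ _ (SymmetricAlgebra.ι K W w)) i =
      algebraMap K _ ((finBasis K W).repr w i) := by
  change fracDer _ _ = _
  rw [fracDer_algebraMap, symDer_ι]
  rfl

theorem grad_ι_basis (i : Fin (finrank K W)) :
    grad K W (algebraMap _ _ (SymmetricAlgebra.ι K W (finBasis K W i))) = Pi.single i 1 := by
  ext j
  rw [grad_ι, Basis.repr_self, Finsupp.single_apply, Pi.single_apply]
  by_cases h : i = j
  · simp [h]
  · simp [h, Ne.symm h]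

theorem span_grad_ι :
    Submodule.span (FractionRing (SymmetricAlgebra K W))
      (Set.range fun w => grad K W (algebraMap _ _ (SymmetricAlgebra.ι K W w))) = ⊤ := by
  rw [eq_top_iff, ← (Pi.basisFun (FractionRing (SymmetricAlgebra K W)) _).span_eq]
  apply Submodule.span_mono
  rintro _ ⟨i, rfl⟩
  exact ⟨finBasis K W i, by rw [Pi.basisFun_apply]; exact grad_ι_basis i⟩

theorem trdeg_fractionRing_symmetricAlgebra :
    Algebra.trdeg K (FractionRing (SymmetricAlgebra K W)) = (finrank K W : Cardinal) := by
  have h1 := IsTranscendenceBasis.mvPolynomial (Fin (finrank K W)) K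
  have h2 := ((SymmetricAlgebra.equivMvPolynomial (finBasis K W)).symm.isTranscendenceBasis_iff).mpr
    h1
  have : Algebra.IsAlgebraic (SymmetricAlgebra K W) (FractionRing (SymmetricAlgebra K W)) :=
    IsLocalization.isAlgebraic _ (nonZeroDivisors (SymmetricAlgebra K W))
  have h3 := h2.algebraMap_comp (A := FractionRing (SymmetricAlgebra K W))
  have := h3.lift_cardinalMk_eq_trdeg
  simpa using this.symm

theorem trdeg_eq_finrank_grad [CharZero K]
    (A : Subalgebra K (FractionRing (SymmetricAlgebra K W))) :
    Algebra.trdeg K A = (finrank (FractionRing (SymmetricAlgebra K W))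
      (Submodule.span (FractionRing (SymmetricAlgebra K W)) (grad K W '' A)) : Cardinal) := by
  apply trdeg_eq_finrank_span
  · rw [eq_top_iff, ← span_grad_ι]
    apply Submodule.span_mono
    rintro _ ⟨w, rfl⟩
    exact ⟨_, rfl⟩
  · rw [trdeg_fractionRing_symmetricAlgebra]
    simp

theorem trdeg_eq_finrank_grad_algebraMap [CharZero K] (A : Subalgebra K (SymmetricAlgebra K W)) :
    Algebra.trdeg K A = (finrank (FractionRing (SymmetricAlgebra K W))
      (Submodule.span (FractionRing (SymmetricAlgebra K W))
        ((fun f => grad K W (algebraMap _ _ f)) '' (A : Set (SymmetricAlgebra K W)))) :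
          Cardinal) := by
  let φ := IsScalarTower.toAlgHom K (SymmetricAlgebra K W) (FractionRing (SymmetricAlgebra K W))
  have hφ : Function.Injective φ := IsFractionRing.injective _ _
  have h1 := (A.equivMapOfInjective φ hφ).trdeg_eq
  rw [h1, trdeg_eq_finrank_grad]
  have h2 : grad K W '' (A.map φ : Set (FractionRing (SymmetricAlgebra K W))) =
      (fun f => grad K W (algebraMap _ _ f)) '' (A : Set (SymmetricAlgebra K W)) := by
    rw [Subalgebra.coe_map, Set.image_image]
    rfl
  rw [h2]

end Gradient

/-! ### The Poisson bracket as a bilinear form in gradients. -/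

section Bracket

variable {K : Type*} [Field K] {g : Type*} [LieRing g] [LieAlgebra K g]

theorem algebraMap_poissonBracket (f₁ f₂ : SymmetricAlgebra K g) :
    algebraMap _ (FractionRing (SymmetricAlgebra K g)) (poissonBracket f₁ f₂) =
      fracPoissonBracket (algebraMap _ _ f₁) (algebraMap _ _ f₂) := by
  rw [fracPoissonBracket, fracDer_algebraMap, poissonBracket]
  change (Algebra.linearMap (SymmetricAlgebra K g) (FractionRing (SymmetricAlgebra K g))).compDer
    (symDer _) f₁ = _
  refine congrArg (fun D : Derivation K (SymmetricAlgebra K g) (FractionRing (SymmetricAlgebra K g))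
    => D f₁) (symDer_ext fun w => ?_)
  simp [symDer_ι, fracHamiltonian, fracDer_algebraMap]

variable [FiniteDimensional K g]

variable (K g) in
/-- The matrix of the Lie-Poisson tensor in a basis of `g`. -/
def poissonMatrix : Matrix (Fin (finrank K g)) (Fin (finrank K g)) (SymmetricAlgebra K g) :=
  Matrix.of fun i j => SymmetricAlgebra.ι K g ⁅finBasis K g i, finBasis K g j⁆

variable (K g) in
/-- The Lie-Poisson tensor as a bilinear form over `Frac S(g)`. -/
def poissonForm : LinearMap.BilinForm (FractionRing (SymmetricAlgebra K g))
    (Fin (finrank K g) → FractionRing (SymmetricAlgebra K g)) :=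
  Matrix.toBilin' ((poissonMatrix K g).map (algebraMap _ _))

theorem poissonForm_grad_ι (ξ η : g) :
    poissonForm K g (grad K g (algebraMap _ _ (SymmetricAlgebra.ι K g ξ)))
        (grad K g (algebraMap _ _ (SymmetricAlgebra.ι K g η))) =
      algebraMap _ _ (SymmetricAlgebra.ι K g ⁅ξ, η⁆) := by
  rw [poissonForm, Matrix.toBilin'_apply]
  conv_rhs => rw [← (finBasis K g).sum_repr ξ, ← (finBasis K g).sum_repr η]
  simp only [grad_ι, Matrix.map_apply, poissonMatrix, Matrix.of_apply]
  simp only [sum_lie, lie_sum, map_sum, smul_lie, lie_smul, map_smul, Algebra.smul_def, map_mul,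
    ← IsScalarTower.algebraMap_apply, Finset.mul_sum]
  rw [Finset.sum_comm]
  refine Finset.sum_congr rfl fun i _ => Finset.sum_congr rfl fun j _ => ?_
  ring

/-- Both sides are derivations in each argument, so agreement on linear functions suffices.
Skew-symmetry and the Leibniz rule in the second argument then come from the form. -/
theorem fracPoissonBracket_eq_poissonForm (F₁ F₂ : FractionRing (SymmetricAlgebra K g)) :
    fracPoissonBracket F₁ F₂ = poissonForm K g (grad K g F₁) (grad K g F₂) := by
  have h1 : ∀ ξ : g, fracHamiltonian K g ξ F₂ =
      poissonForm K g (grad K g (algebraMap _ _ (SymmetricAlgebra.ι K g ξ))) (grad K g F₂) := by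
    intro ξ
    refine congrArg (fun D : Derivation K (FractionRing (SymmetricAlgebra K g))
      (FractionRing (SymmetricAlgebra K g)) => D F₂) (frac_derivation_ext
      (E := (poissonForm K g
        (grad K g (algebraMap _ _ (SymmetricAlgebra.ι K g ξ)))).compDer (grad K g)) fun w => ?_)
    refine Eq.trans ?_ (poissonForm_grad_ι ξ w).symm
    simp [fracHamiltonian, fracDer_algebraMap, hamiltonian, symDer_ι, lieMap]
  refine congrArg (fun D : Derivation K (FractionRing (SymmetricAlgebra K g))
      (FractionRing (SymmetricAlgebra K g)) => D F₁) (frac_derivation_ext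
      (E := ((poissonForm K g).flip (grad K g F₂)).compDer (grad K g)) fun w => ?_)
  refine Eq.trans ?_ (h1 w)
  rw [fracDer_algebraMap, symDer_ι]
  rfl

theorem poissonForm_swap (u v : Fin (finrank K g) → FractionRing (SymmetricAlgebra K g)) :
    poissonForm K g u v = -poissonForm K g v u := by
  rw [poissonForm, Matrix.toBilin'_apply, Matrix.toBilin'_apply, Finset.sum_comm,
    ← Finset.sum_neg_distrib]
  refine Finset.sum_congr rfl fun i _ => ?_
  rw [← Finset.sum_neg_distrib]
  refine Finset.sum_congr rfl fun j _ => ?_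
  rw [Matrix.map_apply, Matrix.map_apply, poissonMatrix, Matrix.of_apply, Matrix.of_apply,
    ← lie_skew, map_neg, map_neg]
  ring

theorem fracPoissonBracket_swap (F₁ F₂ : FractionRing (SymmetricAlgebra K g)) :
    fracPoissonBracket F₁ F₂ = -fracPoissonBracket F₂ F₁ := by
  rw [fracPoissonBracket_eq_poissonForm, fracPoissonBracket_eq_poissonForm,
    poissonForm_swap]

theorem fracPoissonBracket_mul_right (F₁ F₂ F₃ : FractionRing (SymmetricAlgebra K g)) :
    fracPoissonBracket F₁ (F₂ * F₃) =
      F₂ * fracPoissonBracket F₁ F₃ + F₃ * fracPoissonBracket F₁ F₂ := by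
  simp [fracPoissonBracket_eq_poissonForm]

end Bracket

/-! ### Gram determinants, rank and isotropic subspaces. -/

section Gram

variable {k E : Type*} [Field k] [AddCommGroup E] [Module k E] [FiniteDimensional k E]

/-- A nonzero Gram determinant makes the vectors independent modulo the kernel. With the converse
`exists_det_ne_zero`, this expresses rank through determinants, which can be specialized and
deformed. -/
theorem card_add_finrank_ker_le_of_det_ne_zero (Φ : LinearMap.BilinForm k E) {r : ℕ}
    (u : Fin r → E) (hu : (Matrix.of fun i j => Φ (u i) (u j)).det ≠ 0) :
    r + finrank k (LinearMap.ker Φ) ≤ finrank k E := by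
  let f : (Fin r → k) × LinearMap.ker Φ →ₗ[k] E :=
    (Fintype.linearCombination k u).coprod (LinearMap.ker Φ).subtype
  have hf : Function.Injective f := by
    rw [← LinearMap.ker_eq_bot, LinearMap.ker_eq_bot']
    rintro ⟨c, x⟩ h
    have hx : Φ x = 0 := x.2
    have h0 : ∑ i, c i • u i + (x : E) = 0 := h
    have hc : c = 0 := by
      refine Matrix.eq_zero_of_vecMul_eq_zero hu ?_
      ext j
      have h1 := congrArg (fun y => Φ y (u j)) h0
      simpa [hx, Matrix.vecMul, dotProduct] using h1
    subst hc
    simp only [Pi.zero_apply, zero_smul, Finset.sum_const_zero, zero_add] at h0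
    ext
    · rfl
    · exact h0
  have := LinearMap.finrank_le_finrank_of_injective hf
  simpa using this

theorem exists_det_ne_zero (Φ : LinearMap.BilinForm k E) (hΦ : Φ.IsRefl) :
    ∃ u : Fin (finrank k E - finrank k (LinearMap.ker Φ)) → E,
      (Matrix.of fun i j => Φ (u i) (u j)).det ≠ 0 := by
  obtain ⟨U, hU⟩ := Submodule.exists_isCompl (LinearMap.ker Φ)
  have hn : (Φ.restrict U).Nondegenerate := by
    refine LinearMap.BilinForm.nondegenerate_restrict_of_disjoint_orthogonal Φ hΦ ?_
    rw [Submodule.disjoint_def]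
    intro x hx hx'
    have hker : x ∈ LinearMap.ker Φ := by
      rw [LinearMap.mem_ker]
      ext y
      obtain ⟨v, hv, u, hu, rfl⟩ : ∃ v ∈ LinearMap.ker Φ, ∃ u ∈ U, v + u = y := by
        rw [← Submodule.mem_sup, hU.sup_eq_top]
        exact Submodule.mem_top
      have hv' : Φ v x = 0 := by rw [LinearMap.mem_ker.mp hv, LinearMap.zero_apply]
      rw [map_add, hΦ _ _ hv', hΦ _ _ (hx' u hu), add_zero, LinearMap.zero_apply]
    exact (Submodule.disjoint_def.mp hU.disjoint) x hker hx
  have hfr := Submodule.finrank_add_eq_of_isCompl hU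
  have hr : finrank k U = finrank k E - finrank k (LinearMap.ker Φ) := by omega
  let b : Basis (Fin (finrank k E - finrank k (LinearMap.ker Φ))) k U := finBasisOfFinrankEq k U hr
  refine ⟨fun i => b i, ?_⟩
  have := (LinearMap.BilinForm.nondegenerate_iff_det_ne_zero b).mp hn
  convert this using 2
  ext i j
  rw [LinearMap.BilinForm.toMatrix_apply]
  rfl

/-- An isotropic `U` lies in its orthogonal, whose dimension is `dim E - dim U + dim (U ∩ ker Φ)`.
-/
theorem two_mul_finrank_le_of_isotropic (Φ : LinearMap.BilinForm k E) (hΦ : Φ.IsRefl)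
    (U : Submodule k E) (hU : ∀ x ∈ U, ∀ y ∈ U, Φ x y = 0) :
    2 * finrank k U ≤ finrank k E + finrank k (LinearMap.ker Φ) := by
  have h1 := LinearMap.BilinForm.finrank_add_finrank_orthogonal hΦ U
  have h2 : U ≤ Φ.orthogonal U := fun y hy => by
    rw [LinearMap.BilinForm.mem_orthogonal_iff]
    exact fun x hx => hU x hx y hy
  have h3 : U ⊓ Φ.orthogonal ⊤ ≤ LinearMap.ker Φ := by
    rintro x ⟨-, hx⟩
    rw [LinearMap.mem_ker]
    ext y
    exact hΦ _ _ (hx y trivial)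
  have := Submodule.finrank_mono h2
  have := Submodule.finrank_mono h3
  omega

end Gram

/-! ### The index and the upper bound for commutative subalgebras. -/

section Index

variable {K : Type*} [Field K] {g : Type*} [LieRing g] [LieAlgebra K g] [FiniteDimensional K g]

omit [FiniteDimensional K g] in
theorem lieForm_isRefl (x : Dual K g) : (lieForm K g x).IsRefl := by
  intro ξ η h
  change x ⁅η, ξ⁆ = 0
  rw [← lie_skew, map_neg, neg_eq_zero]
  exact h

theorem finrank_ker_poissonForm_le (x : Dual K g) :
    finrank (FractionRing (SymmetricAlgebra K g)) (LinearMap.ker (poissonForm K g)) ≤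
      finrank K (LinearMap.ker (lieForm K g x)) := by
  obtain ⟨u, hu⟩ := exists_det_ne_zero (lieForm K g x) (lieForm_isRefl x)
  let N : Matrix (Fin (finrank K g - finrank K (LinearMap.ker (lieForm K g x))))
      (Fin (finrank K g - finrank K (LinearMap.ker (lieForm K g x)))) (SymmetricAlgebra K g) :=
    Matrix.of fun i j => SymmetricAlgebra.ι K g ⁅u i, u j⁆
  have hN : N.det ≠ 0 := by
    intro h0
    apply hu
    -- Evaluation at `x` turns the polynomial Gram determinant into the one of `lieForm K g x`; a
    -- determinant that is nonzero at a point is nonzero generically.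
    have h1 : SymmetricAlgebra.lift x N.det = 0 := by rw [h0, map_zero]
    rw [AlgHom.map_det] at h1
    rw [← h1]
    congr 1
    ext i j
    exact (SymmetricAlgebra.lift_ι_apply x ⁅u i, u j⁆).symm
  have h2 := card_add_finrank_ker_le_of_det_ne_zero (poissonForm K g)
    (fun i => grad K g (algebraMap _ _ (SymmetricAlgebra.ι K g (u i)))) (by
      have h3 : algebraMap _ (FractionRing (SymmetricAlgebra K g)) N.det ≠ 0 := by
        rwa [Ne, FaithfulSMul.algebraMap_eq_zero_iff]
      rw [RingHom.map_det] at h3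
      refine ne_of_eq_of_ne (congrArg Matrix.det ?_) h3
      ext i j
      exact poissonForm_grad_ι _ _)
  rw [finrank_fin_fun] at h2
  have := Submodule.finrank_le (LinearMap.ker (lieForm K g x))
  omega

omit [FiniteDimensional K g] in
theorem exists_finrank_ker_lieForm_eq_index :
    ∃ x : Dual K g, finrank K (LinearMap.ker (lieForm K g x)) = index K g :=
  Nat.sInf_mem (Set.range_nonempty _)

omit [FiniteDimensional K g] in
theorem index_le (x : Dual K g) : index K g ≤ finrank K (LinearMap.ker (lieForm K g x)) :=
  Nat.sInf_le ⟨x, rfl⟩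

/-- The transcendence degree of a Poisson-commutative subalgebra is at most
`(dim g + ind g) / 2`. -/
theorem two_mul_trdeg_le [CharZero K] (A : Subalgebra K (SymmetricAlgebra K g))
    (hA : ∀ f₁ ∈ A, ∀ f₂ ∈ A, poissonBracket f₁ f₂ = 0) :
    2 * Algebra.trdeg K A ≤ ((finrank K g + index K g : ℕ) : Cardinal) := by
  rw [trdeg_eq_finrank_grad_algebraMap]
  obtain ⟨x, hx⟩ := exists_finrank_ker_lieForm_eq_index (K := K) (g := g)
  have h1 := finrank_ker_poissonForm_le x
  have hrefl : (poissonForm K g).IsRefl := by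
    intro u v h
    rw [poissonForm_swap, h, neg_zero]
  set U := Submodule.span (FractionRing (SymmetricAlgebra K g))
    ((fun f => grad K g (algebraMap _ _ f)) '' (A : Set (SymmetricAlgebra K g)))
  have h2 := two_mul_finrank_le_of_isotropic (poissonForm K g) hrefl U (by
    intro u hu v hv
    induction hu, hv using Submodule.span_induction₂ with
    | mem_mem u v hu hv =>
      obtain ⟨f₁, hf₁, rfl⟩ := hu
      obtain ⟨f₂, hf₂, rfl⟩ := hv
      rw [← fracPoissonBracket_eq_poissonForm, ← algebraMap_poissonBracket, hA f₁ hf₁ f₂ hf₂,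
        map_zero]
    | zero_left => simp
    | zero_right => simp
    | add_left x y z _ _ _ hx hy => rw [map_add, LinearMap.add_apply, hx, hy, add_zero]
    | add_right x y z _ _ _ hx hy => rw [map_add, hx, hy, add_zero]
    | smul_left r x y _ _ h => rw [map_smul, LinearMap.smul_apply, h, smul_zero]
    | smul_right r x y _ _ h => rw [map_smul, h, smul_zero])
  rw [finrank_fin_fun] at h2
  have h3 : 2 * finrank (FractionRing (SymmetricAlgebra K g)) U ≤ finrank K g + index K g := by
    omega
  exact_mod_cast h3

/-- Generic points may be chosen off a hyperplane. -/
theorem exists_finrank_ker_lieForm_eq_index_apply_ne_zero [CharZero K] {e : g} (he : e ≠ 0) :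
    ∃ x : Dual K g, x e ≠ 0 ∧ finrank K (LinearMap.ker (lieForm K g x)) = index K g := by
  obtain ⟨y, hy⟩ := exists_finrank_ker_lieForm_eq_index (K := K) (g := g)
  by_cases hye : y e = 0
  swap
  · exact ⟨y, hye, hy⟩
  obtain ⟨z, hz⟩ : ∃ z : Dual K g, z e ≠ 0 := by
    by_contra! h
    exact he ((Module.forall_dual_apply_eq_zero_iff K e).mp h)
  obtain ⟨u, hu⟩ := exists_det_ne_zero (lieForm K g y) (lieForm_isRefl y)
  let P : Matrix _ _ (Polynomial K) := Matrix.of fun i j =>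
    Polynomial.C (lieForm K g y (u i) (u j)) + Polynomial.X * Polynomial.C (lieForm K g z (u i) (u j))
  have hP : ∀ t, P.det.eval t =
      (Matrix.of fun i j => lieForm K g (y + t • z) (u i) (u j)).det := by
    intro t
    rw [← Polynomial.coe_evalRingHom, RingHom.map_det]
    congr 1
    ext i j
    change Polynomial.eval t
      (Polynomial.C (y ⁅u i, u j⁆) + Polynomial.X * Polynomial.C (z ⁅u i, u j⁆)) =
      (y + t • z) ⁅u i, u j⁆
    simp; exact mul_comm _ _
  -- Along the line `y + t z` the determinant is a polynomial, nonzero at `t = 0`. The factor `X`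
  -- forces `t ≠ 0`, so that `y + t z` does not vanish on `e`.
  obtain ⟨t, ht⟩ : ∃ t, (Polynomial.X * P.det).eval t ≠ 0 := by
    by_contra! h
    have h0 : Polynomial.X * P.det = 0 := Polynomial.funext fun t => by
      rw [h t, Polynomial.eval_zero]
    have h1 : P.det = 0 := (mul_eq_zero.mp h0).resolve_left Polynomial.X_ne_zero
    apply hu
    have h2 := hP 0
    rwa [h1, Polynomial.eval_zero, zero_smul, add_zero, eq_comm] at h2
  rw [Polynomial.eval_mul, Polynomial.eval_X, hP] at ht
  refine ⟨y + t • z, ?_, le_antisymm ?_ (index_le _)⟩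
  · rw [LinearMap.add_apply, hye, zero_add, LinearMap.smul_apply, smul_eq_mul]
    exact mul_ne_zero (left_ne_zero_of_mul ht) hz
  · have h3 := card_add_finrank_ker_le_of_det_ne_zero _ u (right_ne_zero_of_mul ht)
    have h4 := Submodule.finrank_le (LinearMap.ker (lieForm K g y))
    omega

end Index

/-! ### Calculus of Poisson brackets and the inclusion of `S(h)`. -/

section PoissonBasics

variable {K : Type*} [Field K] {g : Type*} [LieRing g] [LieAlgebra K g]

theorem hamiltonian_ι (ξ η : g) :
    hamiltonian K g ξ (SymmetricAlgebra.ι K g η) = SymmetricAlgebra.ι K g ⁅ξ, η⁆ := by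
  simp [hamiltonian, symDer_ι, lieMap]

theorem poissonBracket_ι_left (ξ : g) (f : SymmetricAlgebra K g) :
    poissonBracket (SymmetricAlgebra.ι K g ξ) f = hamiltonian K g ξ f := by
  simp [poissonBracket, symDer_ι]

theorem fracHamiltonian_algebraMap (ξ : g) (f : SymmetricAlgebra K g) :
    fracHamiltonian K g ξ (algebraMap _ _ f) = algebraMap _ _ (hamiltonian K g ξ f) := by
  simp [fracHamiltonian, fracDer_algebraMap]

/-- The derivation `{·, F}` of `Frac S(g)`. -/
def fracPoissonDerivation (F : FractionRing (SymmetricAlgebra K g)) :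
    Derivation K (FractionRing (SymmetricAlgebra K g)) (FractionRing (SymmetricAlgebra K g)) :=
  fracDer (symDer (B := FractionRing (SymmetricAlgebra K g))
    { toFun := fun ξ => fracHamiltonian K g ξ F
      map_add' := fun ξ η => by rw [map_add, Derivation.add_apply]
      map_smul' := fun c ξ => by rw [map_smul, Derivation.smul_apply, RingHom.id_apply] })

theorem fracPoissonBracket_eq (F₁ F₂ : FractionRing (SymmetricAlgebra K g)) :
    fracPoissonBracket F₁ F₂ = fracPoissonDerivation F₂ F₁ := rfl

theorem fracPoissonDerivation_ι (ξ : g) (F : FractionRing (SymmetricAlgebra K g)) :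
    fracPoissonDerivation F (algebraMap _ _ (SymmetricAlgebra.ι K g ξ)) =
      fracHamiltonian K g ξ F := by
  rw [fracPoissonDerivation, fracDer_algebraMap, symDer_ι]
  rfl

/-- The derivation `{·, f}` of `S(g)`. -/
def poissonDerivation (f : SymmetricAlgebra K g) :
    Derivation K (SymmetricAlgebra K g) (SymmetricAlgebra K g) :=
  symDer (B := SymmetricAlgebra K g)
    { toFun := fun ξ => hamiltonian K g ξ f
      map_add' := fun ξ η => by rw [map_add, Derivation.add_apply]
      map_smul' := fun c ξ => by rw [map_smul, Derivation.smul_apply, RingHom.id_apply] }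

theorem poissonBracket_eq (f₁ f₂ : SymmetricAlgebra K g) :
    poissonBracket f₁ f₂ = poissonDerivation f₂ f₁ := rfl

variable [FiniteDimensional K g]

theorem poissonBracket_swap (f₁ f₂ : SymmetricAlgebra K g) :
    poissonBracket f₁ f₂ = -poissonBracket f₂ f₁ := by
  apply IsFractionRing.injective (SymmetricAlgebra K g) (FractionRing (SymmetricAlgebra K g))
  rw [map_neg, algebraMap_poissonBracket, algebraMap_poissonBracket, fracPoissonBracket_swap]

omit [FiniteDimensional K g] in
theorem poissonBracket_adjoin_left {s : Set (SymmetricAlgebra K g)} {f : SymmetricAlgebra K g}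
    (h : ∀ a ∈ s, poissonBracket a f = 0) {a : SymmetricAlgebra K g}
    (ha : a ∈ Algebra.adjoin K s) : poissonBracket a f = 0 := by
  induction ha using Algebra.adjoin_induction with
  | mem a ha => exact h a ha
  | algebraMap r => rw [poissonBracket_eq, Derivation.map_algebraMap]
  | add a b _ _ ha hb =>
    rw [poissonBracket_eq] at ha hb ⊢
    rw [map_add, ha, hb, add_zero]
  | mul a b _ _ ha hb =>
    rw [poissonBracket_eq] at ha hb ⊢
    rw [Derivation.leibniz, ha, hb, smul_zero, smul_zero, add_zero]

theorem poissonBracket_adjoin {s : Set (SymmetricAlgebra K g)}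
    (h : ∀ a ∈ s, ∀ b ∈ s, poissonBracket a b = 0) :
    ∀ a ∈ Algebra.adjoin K s, ∀ b ∈ Algebra.adjoin K s, poissonBracket a b = 0 := by
  intro a ha b hb
  refine poissonBracket_adjoin_left (fun a' ha' => ?_) ha
  rw [poissonBracket_swap, poissonBracket_adjoin_left (fun b' hb' => h b' hb' a' ha') hb, neg_zero]

theorem poissonBracket_eq_zero_of_forall_ι {f p : SymmetricAlgebra K g} {s : Set g}
    (h : ∀ η ∈ s, poissonBracket p (SymmetricAlgebra.ι K g η) = 0)
    (hf : f ∈ Algebra.adjoin K (SymmetricAlgebra.ι K g '' s)) : poissonBracket p f = 0 := by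
  rw [poissonBracket_swap, poissonBracket_adjoin_left ?_ hf, neg_zero]
  rintro _ ⟨η, hη, rfl⟩
  rw [poissonBracket_swap, h η hη, neg_zero]

omit [FiniteDimensional K g] in
theorem symInclusion_ι (h : LieIdeal K g) (η : h) :
    symInclusion h (SymmetricAlgebra.ι K h η) = SymmetricAlgebra.ι K g η := by
  rw [symInclusion, SymmetricAlgebra.lift_ι_apply]
  rfl

omit [FiniteDimensional K g] in
theorem symInclusion_hamiltonian (h : LieIdeal K g) (η : h) (f : SymmetricAlgebra K h) :
    symInclusion h (hamiltonian K h η f) = hamiltonian K g η (symInclusion h f) := by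
  induction f using SymmetricAlgebra.induction with
  | algebraMap r =>
    rw [Derivation.map_algebraMap, AlgHom.commutes, Derivation.map_algebraMap, map_zero]
  | ι x => rw [symInclusion_ι, hamiltonian_ι, hamiltonian_ι, symInclusion_ι]; rfl
  | mul a b ha hb => simp [ha, hb]
  | add a b ha hb => simp [ha, hb]

omit [FiniteDimensional K g] in
theorem symInclusion_poissonBracket (h : LieIdeal K g) (f₁ f₂ : SymmetricAlgebra K h) :
    symInclusion h (poissonBracket f₁ f₂) =
      poissonBracket (symInclusion h f₁) (symInclusion h f₂) := by
  induction f₁ using SymmetricAlgebra.induction with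
  | algebraMap r =>
    rw [AlgHom.commutes, poissonBracket_eq, poissonBracket_eq, Derivation.map_algebraMap,
      Derivation.map_algebraMap, map_zero]
  | ι x =>
    rw [symInclusion_ι, poissonBracket_ι_left, poissonBracket_ι_left, symInclusion_hamiltonian]
  | mul a b ha hb =>
    rw [poissonBracket_eq, poissonBracket_eq] at ha hb ⊢
    simp [ha, hb]
  | add a b ha hb =>
    rw [poissonBracket_eq, poissonBracket_eq] at ha hb ⊢
    simp [ha, hb]

omit [FiniteDimensional K g] in
theorem symInclusion_mem_adjoin (h : LieIdeal K g) (f : SymmetricAlgebra K h) :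
    symInclusion h f ∈ Algebra.adjoin K (SymmetricAlgebra.ι K g '' (h : Set g)) := by
  induction f using SymmetricAlgebra.induction with
  | algebraMap r => rw [AlgHom.commutes]; exact Subalgebra.algebraMap_mem _ r
  | ι x => rw [symInclusion_ι]; exact Algebra.subset_adjoin ⟨x, x.2, rfl⟩
  | mul a b ha hb => rw [map_mul]; exact mul_mem ha hb
  | add a b ha hb => rw [map_add]; exact add_mem ha hb

omit [FiniteDimensional K g] in
theorem symInclusion_injective (h : LieIdeal K g) : Function.Injective (symInclusion h) := by
  obtain ⟨q, hq⟩ := h.toSubmodule.subtype.exists_leftInverse_of_injective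
    (LinearMap.ker_eq_bot.mpr h.toSubmodule.injective_subtype)
  have hcomp : (SymmetricAlgebra.lift (SymmetricAlgebra.ι K h ∘ₗ q)).comp (symInclusion h) =
      AlgHom.id K _ := by
    apply SymmetricAlgebra.algHom_ext
    ext x
    have hx : q x = x := congrArg (fun f => f x) hq
    change SymmetricAlgebra.lift (SymmetricAlgebra.ι K h ∘ₗ q)
      (symInclusion h (SymmetricAlgebra.ι K h x)) = SymmetricAlgebra.ι K h x
    rw [symInclusion_ι, SymmetricAlgebra.lift_ι_apply, LinearMap.comp_apply, hx]
  exact Function.LeftInverse.injective (fun f => congrArg (fun F => F f) hcomp)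

end PoissonBasics

/-! ### The decomposition of `g` into `b` and `V`, and their indices. -/

namespace HeisenbergSplitting

variable {K : Type*} [Field K] {g : Type*} [LieRing g] [LieAlgebra K g]
  {h : LieIdeal K g} {m : ℕ} (D : HeisenbergSplitting h m)

theorem V_le : D.V ≤ h.toSubmodule := D.sup_eq ▸ le_sup_left

theorem e_mem : D.e ∈ h :=
  (D.sup_eq ▸ le_sup_right : Submodule.span K {D.e} ≤ h.toSubmodule)
    (Submodule.mem_span_singleton_self _)

theorem exists_add_smul {x : g} (hx : x ∈ h) : ∃ v ∈ D.V, ∃ c : K, v + c • D.e = x := by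
  have hx' : x ∈ D.V ⊔ Submodule.span K {D.e} := by rw [D.sup_eq]; exact hx
  obtain ⟨v, hv, y, hy, rfl⟩ := Submodule.mem_sup.mp hx'
  obtain ⟨c, rfl⟩ := Submodule.mem_span_singleton.mp hy
  exact ⟨v, hv, c, rfl⟩

theorem exists_dual : ∃ ε : Dual K g, ε D.e = 1 ∧ ∀ v ∈ D.V, ε v = 0 := by
  have he : D.e ∉ D.V := fun hV =>
    D.e_ne_zero ((Submodule.disjoint_def.mp D.disjoint) _ hV (Submodule.mem_span_singleton_self _))
  obtain ⟨f, hf, hV⟩ := Submodule.exists_le_ker_of_notMem he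
  refine ⟨(f D.e)⁻¹ • f, by simp [hf], fun v hv => ?_⟩
  have : f v = 0 := hV hv
  simp [this]

theorem lie_e_of_mem {x : g} (hx : x ∈ h) : ⁅D.e, x⁆ = 0 := by
  obtain ⟨v, hv, c, rfl⟩ := D.exists_add_smul hx
  rw [lie_add, lie_smul, lie_self, smul_zero, add_zero]
  exact D.lie_e ⟨v, hv⟩

theorem e_central (hZ : (LieAlgebra.center K h).toSubmodule.map h.toSubmodule.subtype =
    (LieAlgebra.center K g).toSubmodule) : D.e ∈ LieAlgebra.center K g := by
  have : D.e ∈ (LieAlgebra.center K g).toSubmodule := by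
    rw [← hZ]
    refine ⟨⟨D.e, D.e_mem⟩, ?_, rfl⟩
    intro x
    apply Subtype.ext
    change ⁅(x : g), D.e⁆ = 0
    rw [← lie_skew, D.lie_e_of_mem x.2, neg_zero]
  exact this

/-- For `ξ` in `g` the functional "`e`-component of `[ξ, v]`" on `V` equals `ω(w, ·)` for some `w`,
and `ξ - w` then preserves `V`. Conversely `[x, w] = ω(x, w) e` lies in `V` only if it vanishes. -/
theorem isCompl_b_V [FiniteDimensional K g] : IsCompl D.b.toSubmodule D.V := by
  obtain ⟨ε, he, hV⟩ := D.exists_dual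
  constructor
  · rw [Submodule.disjoint_def]
    intro x hb hx
    have h0 : (⟨x, hx⟩ : D.V) = 0 := by
      refine D.nondegenerate.1 _ fun w => ?_
      have h1 := hV _ (hb w w.2)
      rw [D.lie_V ⟨x, hx⟩ w, map_smul, he, smul_eq_mul, mul_one] at h1
      exact h1
    exact congrArg Subtype.val h0
  · rw [codisjoint_iff, eq_top_iff]
    intro ξ _
    let l : Dual K D.V := ε ∘ₗ lieMap K g ξ ∘ₗ D.V.subtype
    let w : D.V := (D.ω.toDual D.nondegenerate).symm l
    have hw : ∀ v, D.ω w v = ε ⁅ξ, (v : g)⁆ := fun v => by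
      rw [LinearMap.BilinForm.apply_toDual_symm_apply]
      rfl
    refine Submodule.mem_sup.mpr ⟨ξ - w, ?_, w, w.2, sub_add_cancel _ _⟩
    intro v hv
    have hmem : ⁅ξ - (w : g), v⁆ ∈ h := lie_mem_right K g h _ _ (D.V_le hv)
    obtain ⟨u, hu, c, huc⟩ := D.exists_add_smul hmem
    have h1 : ε (u + c • D.e) = 0 := by
      rw [huc, sub_lie, map_sub, D.lie_V w ⟨v, hv⟩, hw, map_smul, he]
      simp
    rw [map_add, hV u hu, map_smul, he] at h1
    have hc : c = 0 := by simpa using h1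
    rw [← huc, hc, zero_smul, add_zero]
    exact hu

theorem finrank_b_add [FiniteDimensional K g] : finrank K D.b + 2 * m = finrank K g := by
  have := Submodule.finrank_add_eq_of_isCompl D.isCompl_b_V
  rw [D.finrank_V] at this
  exact this

theorem finrank_h (D : HeisenbergSplitting h m) [FiniteDimensional K g] :
    finrank K h = 2 * m + 1 := by
  have h1 := Submodule.finrank_sup_add_finrank_inf_eq D.V (Submodule.span K {D.e})
  rw [D.disjoint.eq_bot, D.sup_eq, D.finrank_V, finrank_span_singleton D.e_ne_zero,
    finrank_bot] at h1
  exact h1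

/-- Extend a generic `y` on `b` with `y(e) ≠ 0` by zero on `V`. Then `b` and `V` are orthogonal
because `[b, V] ⊆ V`, and on `V` the form is `y(e) ω`, which is nondegenerate. The kernel thus lies
in `b` and in the kernel of the form of `y`. -/
theorem index_le_index_b [CharZero K] [FiniteDimensional K g] : index K g ≤ index K D.b := by
  have he : (⟨D.e, D.e_mem_b⟩ : D.b) ≠ 0 := fun h0 => D.e_ne_zero (congrArg Subtype.val h0)
  obtain ⟨y, hy, hind⟩ := exists_finrank_ker_lieForm_eq_index_apply_ne_zero (K := K) he
  let q : g →ₗ[K] D.b := D.b.toSubmodule.projectionOnto D.V D.isCompl_b_V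
  have hqb : ∀ β : D.b, q β = β := fun β =>
    Submodule.projectionOnto_apply_left D.isCompl_b_V β
  have hqV : ∀ v ∈ D.V, q v = 0 := fun v hv =>
    Submodule.projectionOnto_apply_right D.isCompl_b_V ⟨v, hv⟩
  refine (index_le (y ∘ₗ q)).trans ?_
  rw [← hind]
  have hker : ∀ ξ ∈ LinearMap.ker (lieForm K g (y ∘ₗ q)), ∃ β : D.b, (β : g) = ξ := by
    intro ξ hξ
    obtain ⟨β, hβ, v, hv, rfl⟩ : ∃ β ∈ D.b.toSubmodule, ∃ v ∈ D.V, β + v = ξ := by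
      rw [← Submodule.mem_sup, D.isCompl_b_V.sup_eq_top]
      exact Submodule.mem_top
    have h0 : (⟨v, hv⟩ : D.V) = 0 := by
      refine D.nondegenerate.1 _ fun w => ?_
      have h1 : y (q ⁅β + v, (w : g)⁆) = 0 :=
        congrArg (fun f : g →ₗ[K] K => f w) (LinearMap.mem_ker.mp hξ)
      rw [add_lie, map_add, hqV _ (hβ w w.2), zero_add, D.lie_V ⟨v, hv⟩ w, map_smul,
        hqb ⟨D.e, D.e_mem_b⟩, map_smul, smul_eq_mul] at h1
      exact (mul_eq_zero.mp h1).resolve_right hy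
    have hv0 : v = 0 := congrArg Subtype.val h0
    exact ⟨⟨β, hβ⟩, by rw [hv0, add_zero]⟩
  let f : LinearMap.ker (lieForm K g (y ∘ₗ q)) →ₗ[K] LinearMap.ker (lieForm K D.b y) :=
    (q ∘ₗ (LinearMap.ker (lieForm K g (y ∘ₗ q))).subtype).codRestrict _ (by
      rintro ⟨ξ, hξ⟩
      obtain ⟨β, rfl⟩ := hker ξ hξ
      rw [LinearMap.mem_ker]
      ext γ
      have h1 : y (q ⁅(β : g), (γ : g)⁆) = 0 :=
        congrArg (fun f : g →ₗ[K] K => f γ) (LinearMap.mem_ker.mp hξ)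
      change y ⁅q β, γ⁆ = 0
      rw [hqb, ← hqb ⁅β, γ⁆]
      exact h1)
  refine LinearMap.finrank_le_finrank_of_injective (f := f) ?_
  rintro ⟨ξ, hξ⟩ ⟨ξ', hξ'⟩ heq
  obtain ⟨β, rfl⟩ := hker ξ hξ
  obtain ⟨β', rfl⟩ := hker ξ' hξ'
  have h1 : q β = q β' := congrArg Subtype.val heq
  rw [hqb, hqb] at h1
  exact Subtype.ext (congrArg (fun γ : D.b => (γ : g)) h1)

end HeisenbergSplitting

/-! ### The quadratic moment map and the polynomials `f_β`. -/

namespace HeisenbergSplitting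

variable {K : Type*} [Field K] {g : Type*} [LieRing g] [LieAlgebra K g]
  {h : LieIdeal K g} {m : ℕ} (D : HeisenbergSplitting h m)

/-- The action of `b` on `V`. -/
def act (γ : D.b) : D.V →ₗ[K] D.V :=
  (lieMap K g γ).restrict γ.2

theorem coe_act (γ : D.b) (v : D.V) : (D.act γ v : g) = ⁅(γ : g), (v : g)⁆ := rfl

/-- Apply the Jacobi identity to `[v, w] = ω(v, w) e`, with `e` central. -/
theorem ω_act (he : D.e ∈ LieAlgebra.center K g) (γ : D.b) (v w : D.V) :
    D.ω (D.act γ v) w = -D.ω v (D.act γ w) := by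
  have h1 : ⁅(γ : g), ⁅(v : g), (w : g)⁆⁆ = 0 := by
    rw [D.lie_V, lie_smul, he γ, smul_zero]
  rw [leibniz_lie, ← D.coe_act, ← D.coe_act, D.lie_V, D.lie_V, ← add_smul] at h1
  exact eq_neg_of_add_eq_zero_left ((smul_eq_zero.mp h1).resolve_right D.e_ne_zero)

variable [FiniteDimensional K g]

/-- The basis of `V` which is left dual to `finBasis` with respect to `ω`. -/
def dual (i : Fin (finrank K D.V)) : D.V := D.ω.dualBasis D.nondegenerate (finBasis K D.V) i

theorem ω_dual (i j : Fin (finrank K D.V)) :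
    D.ω (D.dual i) (finBasis K D.V j) = if j = i then 1 else 0 :=
  LinearMap.BilinForm.apply_dualBasis_left _ _ _ _

theorem sum_ω_dual_smul (v : D.V) : ∑ i, D.ω (D.dual i) v • finBasis K D.V i = v := by
  conv_rhs => rw [← (finBasis K D.V).sum_repr v]
  refine Finset.sum_congr rfl fun i _ => ?_
  congr 1
  conv_lhs => rw [← (finBasis K D.V).sum_repr v]
  simp only [map_sum, map_smul, D.ω_dual, smul_eq_mul, mul_ite, mul_one, mul_zero,
    Finset.sum_ite_eq', Finset.mem_univ, if_true]

theorem sum_ω_smul_dual (v : D.V) : ∑ i, D.ω v (finBasis K D.V i) • D.dual i = v := by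
  conv_rhs => rw [← (D.ω.dualBasis D.nondegenerate (finBasis K D.V)).sum_repr v]
  refine Finset.sum_congr rfl fun i _ => ?_
  rw [LinearMap.BilinForm.dualBasis_repr_apply]
  rfl

theorem quad_apply (β : D.b) :
    D.quad β = -∑ i, SymmetricAlgebra.ι K g (D.act β (finBasis K D.V i) : D.V) *
      SymmetricAlgebra.ι K g (D.dual i : D.V) := by
  rw [quad, LinearMap.neg_apply, LinearMap.sum_apply]
  rfl

theorem fPoly_apply (β : D.b) :
    D.fPoly β = SymmetricAlgebra.ι K g (β : g) * SymmetricAlgebra.ι K g D.e +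
      (2⁻¹ : K) • D.quad β := rfl

/-- The tensor inverse to `ω` is invariant under symplectic maps. The maps `φ` and `ψ` carry this
invariance to any quadratic expression. -/
theorem sum_act_mul_add (he : D.e ∈ LieAlgebra.center K g) (γ : D.b)
    (φ ψ : D.V →ₗ[K] SymmetricAlgebra K g) :
    ∑ i, (φ (D.act γ (finBasis K D.V i)) * ψ (D.dual i) +
      φ (finBasis K D.V i) * ψ (D.act γ (D.dual i))) = 0 := by
  have h1 : ∀ i, φ (D.act γ (finBasis K D.V i)) =
      ∑ j, D.ω (D.dual j) (D.act γ (finBasis K D.V i)) • φ (finBasis K D.V j) := fun i => by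
    conv_lhs => rw [← D.sum_ω_dual_smul (D.act γ (finBasis K D.V i)), map_sum]
    simp only [map_smul]
  have h2 : ∀ i, ψ (D.act γ (D.dual i)) =
      ∑ j, (-D.ω (D.dual i) (D.act γ (finBasis K D.V j))) • ψ (D.dual j) := fun i => by
    conv_lhs => rw [← D.sum_ω_smul_dual (D.act γ (D.dual i)), map_sum]
    simp only [map_smul, D.ω_act he]
  rw [Finset.sum_add_distrib]
  simp only [h1, h2, Finset.sum_mul, Finset.mul_sum]
  rw [Finset.sum_comm, ← Finset.sum_add_distrib]
  refine Finset.sum_eq_zero fun i _ => ?_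
  rw [← Finset.sum_add_distrib]
  refine Finset.sum_eq_zero fun j _ => ?_
  rw [neg_smul, mul_neg, smul_mul_assoc, mul_smul_comm, add_neg_cancel]

/-- Equivariance of the quadratic moment map. -/
theorem hamiltonian_quad (he : D.e ∈ LieAlgebra.center K g) (γ β : D.b) :
    hamiltonian K g γ (D.quad β) = D.quad ⁅γ, β⁆ := by
  rw [quad_apply, quad_apply, map_neg, map_sum]
  congr 1
  -- After expanding the commutator, the two sides differ by the sum of `βγv_i · w_i + βv_i · γw_i`,
  -- which is this invariance with `φ` precomposed by `β`.
  have h0 := D.sum_act_mul_add he γ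
    (SymmetricAlgebra.ι K g ∘ₗ D.V.subtype ∘ₗ D.act β) (SymmetricAlgebra.ι K g ∘ₗ D.V.subtype)
  have hact : ∀ i, D.act ⁅γ, β⁆ (finBasis K D.V i) =
      D.act γ (D.act β (finBasis K D.V i)) - D.act β (D.act γ (finBasis K D.V i)) := fun i =>
    Subtype.ext (lie_lie (γ : g) (β : g) (finBasis K D.V i : g))
  rw [← sub_eq_zero, ← Finset.sum_sub_distrib, ← h0]
  refine Finset.sum_congr rfl fun i _ => ?_
  rw [Derivation.leibniz, hamiltonian_ι, hamiltonian_ι, ← D.coe_act, ← D.coe_act, hact]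
  simp only [smul_eq_mul, LinearMap.comp_apply, Submodule.subtype_apply, Submodule.coe_sub, map_sub]
  ring

theorem hamiltonian_fPoly (he : D.e ∈ LieAlgebra.center K g) (γ β : D.b) :
    hamiltonian K g γ (D.fPoly β) = D.fPoly ⁅γ, β⁆ := by
  rw [fPoly_apply, fPoly_apply, map_add, Derivation.map_smul, D.hamiltonian_quad he,
    Derivation.leibniz, hamiltonian_ι, hamiltonian_ι, he γ, map_zero, smul_zero, zero_add,
    smul_eq_mul, mul_comm]
  rfl

/-- Each of the two factors in the quadratic form contracts back to `-[β, v]`; this is the 2 that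
the coefficient 1/2 in `f_β` cancels. -/
theorem hamiltonian_V_quad (he : D.e ∈ LieAlgebra.center K g) (v : D.V) (β : D.b) :
    hamiltonian K g (v : g) (D.quad β) =
      (2 : K) • (SymmetricAlgebra.ι K g D.e * SymmetricAlgebra.ι K g (D.act β v : D.V)) := by
  have hsum1 : ∑ i, D.ω v (D.act β (finBasis K D.V i)) • D.dual i = -D.act β v := by
    rw [← neg_eq_iff_eq_neg, ← Finset.sum_neg_distrib]
    conv_rhs => rw [← D.sum_ω_smul_dual (D.act β v)]
    refine Finset.sum_congr rfl fun i _ => ?_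
    rw [D.ω_act he, neg_smul]
  have hsum2 : ∑ i, D.ω v (D.dual i) • D.act β (finBasis K D.V i) = -D.act β v := by
    rw [← neg_eq_iff_eq_neg, ← Finset.sum_neg_distrib]
    conv_rhs => rw [← D.sum_ω_dual_smul v, map_sum]
    refine Finset.sum_congr rfl fun i _ => ?_
    rw [← D.alt.neg_eq (D.dual i) v, map_smul, neg_smul, neg_neg]
  rw [quad_apply, map_neg, map_sum]
  have hterm : ∀ i, hamiltonian K g (v : g)
      (SymmetricAlgebra.ι K g (D.act β (finBasis K D.V i) : D.V) *
        SymmetricAlgebra.ι K g (D.dual i : D.V)) =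
      SymmetricAlgebra.ι K g D.e * SymmetricAlgebra.ι K g
        (((D.ω v (D.act β (finBasis K D.V i)) • D.dual i : D.V) : g) +
          ((D.ω v (D.dual i) • D.act β (finBasis K D.V i) : D.V) : g)) := by
    intro i
    rw [Derivation.leibniz, hamiltonian_ι, hamiltonian_ι, D.lie_V, D.lie_V]
    simp only [smul_eq_mul, map_smul, map_add, Submodule.coe_smul, mul_add, mul_smul_comm]
    rw [add_comm, mul_comm, mul_comm (SymmetricAlgebra.ι K g (D.act β (finBasis K D.V i) : g))]
  simp only [hterm]
  rw [← Finset.mul_sum, ← map_sum, Finset.sum_add_distrib, ← Submodule.coe_sum,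
    ← Submodule.coe_sum, hsum1, hsum2, Submodule.coe_neg, map_add, map_neg, two_smul]
  ring

/-- For `v` in `V`, the quadratic term contributes `e [β, v]` and the term `βe` contributes `e [v,
β]`. -/
theorem hamiltonian_fPoly_of_mem [CharZero K] (he : D.e ∈ LieAlgebra.center K g) {η : g}
    (hη : η ∈ h) (β : D.b) : hamiltonian K g η (D.fPoly β) = 0 := by
  have hec : hamiltonian K g D.e (D.fPoly β) = 0 := by
    have h1 := D.hamiltonian_fPoly he ⟨D.e, D.e_mem_b⟩ β
    have h2 : ⁅(⟨D.e, D.e_mem_b⟩ : D.b), β⁆ = 0 := by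
      apply Subtype.ext
      change ⁅D.e, (β : g)⁆ = 0
      rw [← lie_skew, he β, neg_zero]
    rw [h2, map_zero] at h1
    exact h1
  have hv : ∀ v : D.V, hamiltonian K g (v : g) (D.fPoly β) = 0 := fun v => by
    rw [fPoly_apply, map_add, Derivation.map_smul, D.hamiltonian_V_quad he, smul_smul,
      inv_mul_cancel₀ two_ne_zero, one_smul, Derivation.leibniz, hamiltonian_ι, hamiltonian_ι,
      he v, map_zero, smul_zero, zero_add, ← lie_skew, map_neg, D.coe_act, smul_eq_mul, mul_neg,
      neg_add_cancel]
  obtain ⟨v, hv', c, rfl⟩ := D.exists_add_smul hη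
  rw [map_add, map_smul, Derivation.add_apply, Derivation.smul_apply, hec, hv ⟨v, hv'⟩, smul_zero,
    add_zero]

/-! ### The homomorphism `f ↦ f̃`: brackets, injectivity, values. -/

/-- The element `e` in the fraction field. -/
def fracE : FractionRing (SymmetricAlgebra K g) := algebraMap _ _ (SymmetricAlgebra.ι K g D.e)

omit [FiniteDimensional K g] in
theorem ι_e_ne_zero : SymmetricAlgebra.ι K g D.e ≠ 0 := by
  obtain ⟨ε, he, -⟩ := D.exists_dual
  intro h0
  have h1 := congrArg (SymmetricAlgebra.lift ε) h0
  rw [SymmetricAlgebra.lift_ι_apply, he, map_zero] at h1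
  exact one_ne_zero h1

omit [FiniteDimensional K g] in
theorem fracE_ne_zero : D.fracE ≠ 0 := by
  rw [fracE, Ne, FaithfulSMul.algebraMap_eq_zero_iff]
  exact D.ι_e_ne_zero

theorem tilde_ι (β : D.b) :
    D.tilde (SymmetricAlgebra.ι K D.b β) = algebraMap _ _ (D.fPoly β) * D.fracE⁻¹ := by
  rw [tilde, SymmetricAlgebra.lift_ι_apply]
  rfl

theorem tilde_ι_eq (β : D.b) :
    D.tilde (SymmetricAlgebra.ι K D.b β) = algebraMap _ _ (SymmetricAlgebra.ι K g (β : g)) +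
      (2⁻¹ : K) • (algebraMap _ _ (D.quad β) * D.fracE⁻¹) := by
  rw [tilde_ι, fPoly_apply, map_add, map_mul, add_mul, ← fracE, mul_assoc,
    mul_inv_cancel₀ D.fracE_ne_zero, mul_one, ← smul_mul_assoc]
  congr 2
  exact map_smul (IsScalarTower.toAlgHom K (SymmetricAlgebra K g)
    (FractionRing (SymmetricAlgebra K g))) _ _

theorem tilde_e :
    D.tilde (SymmetricAlgebra.ι K D.b ⟨D.e, D.e_mem_b⟩) = D.fracE := by
  have h0 : D.quad ⟨D.e, D.e_mem_b⟩ = 0 := by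
    rw [quad_apply, Finset.sum_eq_zero, neg_zero]
    intro i _
    have : D.act ⟨D.e, D.e_mem_b⟩ (finBasis K D.V i) = 0 := Subtype.ext (D.lie_e _)
    rw [this, Submodule.coe_zero, map_zero, zero_mul]
  rw [tilde_ι_eq, h0, map_zero, zero_mul, smul_zero, add_zero]
  rfl

omit [FiniteDimensional K g] in
theorem fracHamiltonian_fracE (he : D.e ∈ LieAlgebra.center K g) (ξ : g) :
    fracHamiltonian K g ξ D.fracE = 0 := by
  rw [fracE, fracHamiltonian_algebraMap, hamiltonian_ι, he ξ, map_zero, map_zero]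

theorem fracHamiltonian_tilde [CharZero K] (he : D.e ∈ LieAlgebra.center K g) {η : g} (hη : η ∈ h)
    (f : SymmetricAlgebra K D.b) : fracHamiltonian K g η (D.tilde f) = 0 := by
  induction f using SymmetricAlgebra.induction with
  | algebraMap r => rw [AlgHom.commutes, Derivation.map_algebraMap]
  | ι β =>
    rw [tilde_ι, Derivation.leibniz, Derivation.leibniz_inv, D.fracHamiltonian_fracE he,
      fracHamiltonian_algebraMap, D.hamiltonian_fPoly_of_mem he hη, map_zero]
    simp only [smul_zero, add_zero]
  | mul a b ha hb => rw [map_mul, Derivation.leibniz, ha, hb, smul_zero, smul_zero, add_zero]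
  | add a b ha hb => rw [map_add, map_add, ha, hb, add_zero]

/-- Since `f̃_γ` commutes with `h`, the quadratic part of `f̃_β` and its denominator `e` drop out.
What remains is `{β, f̃_γ}`, given by equivariance. -/
theorem fracPoissonBracket_tilde_ι [CharZero K] (he : D.e ∈ LieAlgebra.center K g) (β γ : D.b) :
    fracPoissonBracket (D.tilde (SymmetricAlgebra.ι K D.b β))
      (D.tilde (SymmetricAlgebra.ι K D.b γ)) = D.tilde (SymmetricAlgebra.ι K D.b ⁅β, γ⁆) := by
  have hh : ∀ η ∈ h, fracPoissonDerivation (D.tilde (SymmetricAlgebra.ι K D.b γ))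
      (algebraMap _ _ (SymmetricAlgebra.ι K g η)) = 0 := fun η hη => by
    rw [fracPoissonDerivation_ι, D.fracHamiltonian_tilde he hη]
  have hE : fracPoissonDerivation (D.tilde (SymmetricAlgebra.ι K D.b γ)) D.fracE = 0 :=
    hh _ D.e_mem
  have hq : fracPoissonDerivation (D.tilde (SymmetricAlgebra.ι K D.b γ))
      (algebraMap _ _ (D.quad β)) = 0 := by
    rw [quad_apply, map_neg, map_neg, map_sum, map_sum, Finset.sum_eq_zero, neg_zero]
    intro i _
    rw [map_mul, Derivation.leibniz, hh _ (D.V_le (Subtype.prop _)),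
      hh _ (D.V_le (Subtype.prop _)), smul_zero, smul_zero, add_zero]
  rw [fracPoissonBracket_eq, D.tilde_ι_eq β, map_add, Derivation.map_smul, Derivation.leibniz,
    Derivation.leibniz_inv, hE, hq, fracPoissonDerivation_ι]
  simp only [smul_zero, add_zero]
  rw [tilde_ι, Derivation.leibniz, Derivation.leibniz_inv, D.fracHamiltonian_fracE he,
    fracHamiltonian_algebraMap, D.hamiltonian_fPoly he, tilde_ι, smul_zero, smul_zero, zero_add,
    smul_eq_mul, mul_comm]

theorem tilde_poissonBracket [CharZero K] (he : D.e ∈ LieAlgebra.center K g)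
    (f₁ f₂ : SymmetricAlgebra K D.b) :
    D.tilde (poissonBracket f₁ f₂) = fracPoissonBracket (D.tilde f₁) (D.tilde f₂) := by
  induction f₁ using SymmetricAlgebra.induction with
  | algebraMap r =>
    rw [AlgHom.commutes, poissonBracket_eq, fracPoissonBracket_eq, Derivation.map_algebraMap,
      Derivation.map_algebraMap, map_zero]
  | ι β =>
    rw [poissonBracket_ι_left]
    induction f₂ using SymmetricAlgebra.induction with
    | algebraMap r =>
      rw [AlgHom.commutes, fracPoissonBracket_swap, fracPoissonBracket_eq,
        Derivation.map_algebraMap, Derivation.map_algebraMap, map_zero, neg_zero]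
    | ι γ => rw [hamiltonian_ι, D.fracPoissonBracket_tilde_ι he]
    | mul a b ha hb =>
      rw [map_mul D.tilde, fracPoissonBracket_mul_right, ← ha, ← hb, Derivation.leibniz]
      simp
    | add a b ha hb =>
      rw [fracPoissonBracket_eq_poissonForm] at ha hb ⊢
      rw [map_add, map_add, map_add, map_add, map_add, ha, hb]
  | mul a b ha hb =>
    rw [poissonBracket_eq, fracPoissonBracket_eq] at ha hb ⊢
    rw [Derivation.leibniz, map_mul, Derivation.leibniz, ← ha, ← hb]
    simp
  | add a b ha hb =>
    rw [poissonBracket_eq, fracPoissonBracket_eq] at ha hb ⊢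
    rw [map_add, map_add, map_add, map_add, ha, hb]

/-- The homomorphism `S(g) → S(b)` that kills `V`. -/
def retract : SymmetricAlgebra K g →ₐ[K] SymmetricAlgebra K D.b :=
  SymmetricAlgebra.lift (SymmetricAlgebra.ι K D.b ∘ₗ
    D.b.toSubmodule.projectionOnto D.V D.isCompl_b_V)

theorem retract_ι_b (β : D.b) :
    D.retract (SymmetricAlgebra.ι K g (β : g)) = SymmetricAlgebra.ι K D.b β := by
  rw [retract, SymmetricAlgebra.lift_ι_apply, LinearMap.comp_apply]
  exact congrArg _ (Submodule.projectionOnto_apply_left D.isCompl_b_V β)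

theorem retract_ι_V (v : D.V) : D.retract (SymmetricAlgebra.ι K g (v : g)) = 0 := by
  rw [retract, SymmetricAlgebra.lift_ι_apply, LinearMap.comp_apply]
  exact (congrArg _ (Submodule.projectionOnto_apply_right D.isCompl_b_V v)).trans (map_zero _)

theorem retract_fPoly (β : D.b) : D.retract (D.fPoly β) =
    SymmetricAlgebra.ι K D.b β * SymmetricAlgebra.ι K D.b ⟨D.e, D.e_mem_b⟩ := by
  have h0 : D.retract (D.quad β) = 0 := by
    rw [quad_apply, map_neg, map_sum, Finset.sum_eq_zero, neg_zero]
    intro i _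
    rw [map_mul, D.retract_ι_V, zero_mul]
  rw [fPoly_apply, map_add, map_smul, h0, smul_zero, add_zero, map_mul, D.retract_ι_b]
  exact congrArg _ (D.retract_ι_b ⟨D.e, D.e_mem_b⟩)

/-- Clearing denominators while following the numerator under `V ↦ 0`. If `f̃ = 0`, the numerator
vanishes, so `f e^N = 0` in a domain: this is the injectivity of `f ↦ f̃`. -/
theorem exists_numerator (f : SymmetricAlgebra K D.b) :
    ∃ (N : ℕ) (p : SymmetricAlgebra K g), D.tilde f * D.fracE ^ N = algebraMap _ _ p ∧
      D.retract p = f * SymmetricAlgebra.ι K D.b ⟨D.e, D.e_mem_b⟩ ^ N := by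
  have hre : D.retract (SymmetricAlgebra.ι K g D.e) =
      SymmetricAlgebra.ι K D.b ⟨D.e, D.e_mem_b⟩ := D.retract_ι_b ⟨D.e, D.e_mem_b⟩
  induction f using SymmetricAlgebra.induction with
  | algebraMap r =>
    refine ⟨0, algebraMap _ _ r, ?_, ?_⟩
    · rw [AlgHom.commutes, pow_zero, mul_one, ← IsScalarTower.algebraMap_apply]
    · rw [AlgHom.commutes, pow_zero, mul_one]
  | ι β =>
    refine ⟨1, D.fPoly β, ?_, ?_⟩
    · rw [tilde_ι, pow_one, inv_mul_cancel_right₀ D.fracE_ne_zero]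
    · rw [retract_fPoly, pow_one]
  | mul a b ha hb =>
    obtain ⟨N, p, hp, hp'⟩ := ha
    obtain ⟨M, q, hq, hq'⟩ := hb
    refine ⟨N + M, p * q, ?_, ?_⟩
    · rw [map_mul, map_mul, ← hp, ← hq]
      ring
    · rw [map_mul, hp', hq']
      ring
  | add a b ha hb =>
    obtain ⟨N, p, hp, hp'⟩ := ha
    obtain ⟨M, q, hq, hq'⟩ := hb
    refine ⟨N + M, p * SymmetricAlgebra.ι K g D.e ^ M + q * SymmetricAlgebra.ι K g D.e ^ N, ?_, ?_⟩
    · rw [map_add, map_add, map_mul, map_mul, ← hp, ← hq, map_pow, map_pow, ← fracE]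
      ring
    · rw [map_add, map_mul, map_mul, hp', hq', map_pow, map_pow, hre]
      ring

theorem tilde_injective : Function.Injective D.tilde := by
  rw [injective_iff_map_eq_zero]
  intro f hf
  obtain ⟨N, p, hp, hp'⟩ := D.exists_numerator f
  rw [hf, zero_mul, eq_comm, FaithfulSMul.algebraMap_eq_zero_iff] at hp
  rw [hp, map_zero, eq_comm, mul_eq_zero] at hp'
  refine hp'.resolve_right (pow_ne_zero _ fun h0 => ?_)
  obtain ⟨ε, he, -⟩ := D.exists_dual
  let φ : D.b →ₗ[K] K := ε ∘ₗ D.b.toSubmodule.subtype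
  have h2 := congrArg (SymmetricAlgebra.lift φ) h0
  rw [SymmetricAlgebra.lift_ι_apply, map_zero] at h2
  exact one_ne_zero (he.symm.trans h2)

theorem mem_ann_of_fracHamiltonian {p : SymmetricAlgebra K g}
    (hp : ∀ η ∈ h, fracHamiltonian K g η (algebraMap _ _ p) = 0) : p ∈ ann h := by
  intro η hη
  rw [poissonBracket_swap, poissonBracket_ι_left, neg_eq_zero]
  have := hp η hη
  rwa [fracHamiltonian_algebraMap, FaithfulSMul.algebraMap_eq_zero_iff] at this

theorem tilde_mem_annFrac [CharZero K] (he : D.e ∈ LieAlgebra.center K g)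
    (f : SymmetricAlgebra K D.b) : D.tilde f ∈ annFrac h := by
  obtain ⟨N, p, hp, -⟩ := D.exists_numerator f
  have hmem : SymmetricAlgebra.ι K g D.e ∈ centerPolynomials K g :=
    Algebra.subset_adjoin ⟨D.e, he, rfl⟩
  refine ⟨p, mem_ann_of_fracHamiltonian fun η hη => ?_, SymmetricAlgebra.ι K g D.e ^ N,
    pow_mem hmem N, pow_ne_zero _ D.ι_e_ne_zero, ?_⟩
  · rw [← hp, Derivation.leibniz, Derivation.leibniz_pow, D.fracHamiltonian_fracE he,
      D.fracHamiltonian_tilde he hη]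
    simp only [smul_zero, add_zero]
  · rw [← hp, map_pow, ← fracE, mul_div_cancel_right₀ _ (pow_ne_zero _ D.fracE_ne_zero)]

theorem polynomialPart_le_ann [CharZero K] (he : D.e ∈ LieAlgebra.center K g)
    (A : Subalgebra K (SymmetricAlgebra K D.b)) : D.polynomialPart A ≤ ann h := by
  rintro p ⟨f, -, hf⟩
  refine mem_ann_of_fracHamiltonian fun η hη => ?_
  have hf' : D.tilde f = algebraMap _ _ p := hf
  rw [← hf', D.fracHamiltonian_tilde he hη]

end HeisenbergSplitting

/-! ### Dimension counts for spans of differentials. -/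

theorem finrank_span_range_le {K F U M : Type*} [Field K] [Field F] [Algebra K F]
    [AddCommGroup U] [Module K U] [FiniteDimensional K U] [AddCommGroup M] [Module K M] [Module F M]
    [IsScalarTower K F M] (δ : U →ₗ[K] M) :
    finrank F (Submodule.span F (Set.range δ)) ≤ finrank K U := by
  have h1 : Submodule.span F (Set.range δ) =
      Submodule.span F (Set.range fun i => δ (finBasis K U i)) := by
    apply le_antisymm
    · rw [Submodule.span_le]
      rintro _ ⟨u, rfl⟩
      rw [← (finBasis K U).sum_repr u, map_sum]
      refine Submodule.sum_mem _ fun i _ => ?_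
      rw [map_smul, ← algebraMap_smul F]
      exact Submodule.smul_mem _ _ (Submodule.subset_span ⟨i, rfl⟩)
    · apply Submodule.span_mono
      rintro _ ⟨i, rfl⟩
      exact ⟨_, rfl⟩
  rw [h1]
  exact (finrank_range_le_card (R := F) fun i => δ (finBasis K U i)).trans_eq (Fintype.card_fin _)

/-- The overlap of `P` and `Q` is at most that of `P₀` and `Q₀`, whose dimension is fixed because
they span everything. -/
theorem finrank_add_finrank_le_of_sup_eq_top {F M : Type*} [Field F] [AddCommGroup M] [Module F M]
    [FiniteDimensional F M] {P Q P₀ Q₀ C : Submodule F M} (hP : P ≤ P₀) (hQ : Q ≤ Q₀) (hPC : P ≤ C)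
    (hQC : Q ≤ C) (htop : P₀ ⊔ Q₀ = ⊤) :
    finrank F P + finrank F Q + finrank F M ≤ finrank F C + finrank F P₀ + finrank F Q₀ := by
  have h0 := Submodule.finrank_sup_add_finrank_inf_eq P₀ Q₀
  have h1 := Submodule.finrank_sup_add_finrank_inf_eq P Q
  rw [htop, finrank_top] at h0
  have h2 := Submodule.finrank_mono (inf_le_inf hP hQ)
  have h3 := Submodule.finrank_mono (sup_le hPC hQC)
  omega

section GradSpan

variable {K : Type*} [Field K] {W : Type*} [AddCommGroup W] [Module K W] [FiniteDimensional K W]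

variable (K W) in
/-- The differential of a linear coordinate. -/
def gradι : W →ₗ[K] (Fin (finrank K W) → FractionRing (SymmetricAlgebra K W)) :=
  (grad K W : _ →ₗ[K] _) ∘ₗ (IsScalarTower.toAlgHom K (SymmetricAlgebra K W)
    (FractionRing (SymmetricAlgebra K W))).toLinearMap ∘ₗ SymmetricAlgebra.ι K W

theorem grad_mem_of_mem_adjoin {s : Set W} {f : SymmetricAlgebra K W}
    (hf : f ∈ Algebra.adjoin K (SymmetricAlgebra.ι K W '' s)) :
    grad K W (algebraMap _ _ f) ∈
      Submodule.span (FractionRing (SymmetricAlgebra K W)) (gradι K W '' s) := by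
  induction hf using Algebra.adjoin_induction with
  | mem f hf =>
    obtain ⟨w, hw, rfl⟩ := hf
    exact Submodule.subset_span ⟨w, hw, rfl⟩
  | algebraMap r =>
    rw [← IsScalarTower.algebraMap_apply, Derivation.map_algebraMap]
    exact Submodule.zero_mem _
  | add a b _ _ ha hb => rw [map_add, map_add]; exact Submodule.add_mem _ ha hb
  | mul a b _ _ ha hb =>
    rw [map_mul, Derivation.leibniz]
    exact Submodule.add_mem _ (Submodule.smul_mem _ _ hb) (Submodule.smul_mem _ _ ha)

theorem finrank_span_gradι_le (U : Submodule K W) :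
    finrank (FractionRing (SymmetricAlgebra K W))
      (Submodule.span (FractionRing (SymmetricAlgebra K W)) (gradι K W '' U)) ≤ finrank K U := by
  have := finrank_span_range_le (F := FractionRing (SymmetricAlgebra K W)) (gradι K W ∘ₗ U.subtype)
  have hr : Set.range (gradι K W ∘ₗ U.subtype) = gradι K W '' U := by
    rw [LinearMap.coe_comp, Set.range_comp, Submodule.coe_subtype, Subtype.range_coe]
  rwa [hr] at this

theorem le_finrank_span_gradι (U : Submodule K W) : finrank K U ≤
    finrank (FractionRing (SymmetricAlgebra K W))
      (Submodule.span (FractionRing (SymmetricAlgebra K W)) (gradι K W '' U)) := by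
  obtain ⟨U', hU'⟩ := Submodule.exists_isCompl U
  have h1 := finrank_span_gradι_le U'
  have h2 : Submodule.span (FractionRing (SymmetricAlgebra K W)) (gradι K W '' U) ⊔
      Submodule.span (FractionRing (SymmetricAlgebra K W)) (gradι K W '' U') = ⊤ := by
    rw [eq_top_iff, ← span_grad_ι, Submodule.span_le]
    rintro _ ⟨w, rfl⟩
    obtain ⟨u, hu, v, hv, rfl⟩ : ∃ u ∈ U, ∃ v ∈ U', u + v = w := by
      rw [← Submodule.mem_sup, hU'.sup_eq_top]
      exact Submodule.mem_top
    have h3 := Submodule.add_mem_sup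
      (Submodule.subset_span (R := FractionRing (SymmetricAlgebra K W))
        (Set.mem_image_of_mem (gradι K W) hu))
      (Submodule.subset_span (R := FractionRing (SymmetricAlgebra K W))
        (Set.mem_image_of_mem (gradι K W) hv))
    rw [← map_add] at h3
    exact h3
  have h4 := Submodule.finrank_add_le_finrank_add_finrank
    (Submodule.span (FractionRing (SymmetricAlgebra K W)) (gradι K W '' U))
    (Submodule.span (FractionRing (SymmetricAlgebra K W)) (gradι K W '' U'))
  rw [h2, finrank_top, finrank_fin_fun] at h4
  have h5 := Submodule.finrank_add_eq_of_isCompl hU'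
  omega

end GradSpan

/-! ### Complete algebras on `h`, and completeness on `g`. -/

namespace HeisenbergSplitting

variable {K : Type*} [Field K] {g : Type*} [LieRing g] [LieAlgebra K g]
  {h : LieIdeal K g} {m : ℕ} (D : HeisenbergSplitting h m) [FiniteDimensional K g]

theorem one_le_index_h (D : HeisenbergSplitting h m) : 1 ≤ index K h := by
  obtain ⟨x, hx⟩ := exists_finrank_ker_lieForm_eq_index (K := K) (g := h)
  rw [← hx, Nat.one_le_iff_ne_zero, Ne, Submodule.finrank_eq_zero]
  intro h0
  have h1 : (⟨D.e, D.e_mem⟩ : h) ∈ LinearMap.ker (lieForm K h x) := by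
    rw [LinearMap.mem_ker]
    ext η
    have h2 : ⁅(⟨D.e, D.e_mem⟩ : h), η⁆ = 0 := Subtype.ext (D.lie_e_of_mem η.2)
    exact (congrArg x h2).trans (map_zero x)
  rw [h0, Submodule.mem_bot] at h1
  exact D.e_ne_zero (congrArg Subtype.val h1)

omit [FiniteDimensional K g] in
theorem index_h_le_one (D : HeisenbergSplitting h m) : index K h ≤ 1 := by
  obtain ⟨ε, he, hV⟩ := D.exists_dual
  refine (index_le (ε ∘ₗ h.toSubmodule.subtype)).trans ?_
  refine le_trans (Submodule.finrank_mono ?_)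
    (finrank_span_singleton (K := K) (v := (⟨D.e, D.e_mem⟩ : h))
      fun h0 => D.e_ne_zero (congrArg Subtype.val h0)).le
  rintro ⟨ξ, hξ⟩ hk
  obtain ⟨v, hv, c, rfl⟩ := D.exists_add_smul hξ
  have h0 : (⟨v, hv⟩ : D.V) = 0 := by
    refine D.nondegenerate.1 _ fun w => ?_
    have h1 : ε ⁅v + c • D.e, (w : g)⁆ = 0 :=
      congrArg (fun f : h →ₗ[K] K => f ⟨w, D.V_le w.2⟩) (LinearMap.mem_ker.mp hk)
    rw [add_lie, smul_lie, D.lie_e w, smul_zero, add_zero, D.lie_V ⟨v, hv⟩ w, map_smul, he,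
      smul_eq_mul, mul_one] at h1
    exact h1
  have hv0 : v = 0 := congrArg Subtype.val h0
  refine Submodule.mem_span_singleton.mpr ⟨c, Subtype.ext ?_⟩
  change c • D.e = v + c • D.e
  rw [hv0, zero_add]

theorem exists_lagrangian : ∃ L : Submodule K D.V,
    (∀ v ∈ L, ∀ w ∈ L, D.ω v w = 0) ∧ m ≤ finrank K L := by
  obtain ⟨L, hL⟩ := exists_maximal_of_wellFoundedGT
    (fun L : Submodule K D.V => ∀ v ∈ L, ∀ w ∈ L, D.ω v w = 0) ⟨⊥, by
      intro v hv w _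
      rw [(Submodule.mem_bot K).mp hv, map_zero, LinearMap.zero_apply]⟩
  refine ⟨L, hL.prop, ?_⟩
  have hle : D.ω.orthogonal L ≤ L := by
    intro x hx
    have h1 : ∀ v ∈ L, D.ω v x = 0 := hx
    have h2 : ∀ v ∈ L, D.ω x v = 0 := fun v hv => D.alt.isRefl _ _ (h1 v hv)
    -- A vector orthogonal to `L` can be adjoined to it without losing isotropy, so by maximality it
    -- already lies in `L`.
    refine hL.le_of_ge (y := L ⊔ Submodule.span K {x}) ?_ le_sup_left
      ((le_sup_right : _ ≤ L ⊔ Submodule.span K {x}) (Submodule.mem_span_singleton_self x))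
    intro v hv w hw
    obtain ⟨v', hv', a, ha, rfl⟩ := Submodule.mem_sup.mp hv
    obtain ⟨w', hw', b, hb, rfl⟩ := Submodule.mem_sup.mp hw
    obtain ⟨a, rfl⟩ := Submodule.mem_span_singleton.mp ha
    obtain ⟨b, rfl⟩ := Submodule.mem_span_singleton.mp hb
    have hxx : D.ω x x = 0 := D.alt x
    simp [hL.prop v' hv' w' hw', h1 v' hv', h2 w' hw', hxx]
  have h3 := LinearMap.BilinForm.finrank_orthogonal D.nondegenerate L
  have h4 := Submodule.finrank_mono hle
  have h5 := D.finrank_V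
  omega

/-- Polynomials in the abelian subalgebra spanned by a Lagrangian subspace and `e` have `m + 1`
independent differentials, and `2(m + 1) ≥ dim h + ind h`. -/
theorem exists_isCompleteCommutative_h (D : HeisenbergSplitting h m) [CharZero K] :
    ∃ B : Subalgebra K (SymmetricAlgebra K h), IsCompleteCommutative B := by
  obtain ⟨L, hL, hLm⟩ := D.exists_lagrangian
  let U : Submodule K h :=
    L.map (Submodule.inclusion D.V_le) ⊔ Submodule.span K {(⟨D.e, D.e_mem⟩ : h)}
  have hlie : ∀ ξ ∈ U, ∀ η ∈ U, ⁅ξ, η⁆ = 0 := by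
    intro ξ hξ η hη
    obtain ⟨_, ⟨v, hv, rfl⟩, y, hy, rfl⟩ := Submodule.mem_sup.mp hξ
    obtain ⟨_, ⟨w, hw, rfl⟩, z, hz, rfl⟩ := Submodule.mem_sup.mp hη
    obtain ⟨a, rfl⟩ := Submodule.mem_span_singleton.mp hy
    obtain ⟨b, rfl⟩ := Submodule.mem_span_singleton.mp hz
    apply Subtype.ext
    change ⁅(v : g) + a • D.e, (w : g) + b • D.e⁆ = 0
    rw [add_lie, lie_add, smul_lie, D.lie_e_of_mem (h.add_mem (D.V_le w.2) (h.smul_mem b D.e_mem)),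
      smul_zero, add_zero, D.lie_V, hL v hv w hw, zero_smul, zero_add, lie_smul, ← lie_skew,
      D.lie_e, neg_zero, smul_zero]
  have hfr : m + 1 ≤ finrank K U := by
    have h1 := Submodule.finrank_sup_add_finrank_inf_eq (L.map (Submodule.inclusion D.V_le))
      (Submodule.span K {(⟨D.e, D.e_mem⟩ : h)})
    have h2 : L.map (Submodule.inclusion D.V_le) ⊓ Submodule.span K {(⟨D.e, D.e_mem⟩ : h)} = ⊥ := by
      rw [eq_bot_iff]
      rintro _ ⟨⟨v, -, rfl⟩, hy⟩
      obtain ⟨a, ha⟩ := Submodule.mem_span_singleton.mp hy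
      have hae : a • D.e = v := congrArg Subtype.val ha
      have hv0 : (v : g) = 0 := (Submodule.disjoint_def.mp D.disjoint) _ v.2
        (Submodule.mem_span_singleton.mpr ⟨a, hae⟩)
      rw [Submodule.mem_bot]
      exact Subtype.ext hv0
    rw [h2, finrank_bot, finrank_span_singleton (fun h0 => D.e_ne_zero (congrArg Subtype.val h0)),
      ← (Submodule.equivMapOfInjective _ (Submodule.inclusion_injective D.V_le) L).finrank_eq] at h1
    change finrank K U + 0 = finrank K L + 1 at h1
    omega
  have hcomm : ∀ f₁ ∈ Algebra.adjoin K (SymmetricAlgebra.ι K h '' (U : Set h)),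
      ∀ f₂ ∈ Algebra.adjoin K (SymmetricAlgebra.ι K h '' (U : Set h)),
        poissonBracket f₁ f₂ = 0 := by
    apply poissonBracket_adjoin
    rintro _ ⟨ξ, hξ, rfl⟩ _ ⟨η, hη, rfl⟩
    rw [poissonBracket_ι_ι, hlie ξ hξ η hη, map_zero]
  refine ⟨_, hcomm, le_antisymm (two_mul_trdeg_le _ hcomm) ?_⟩
  rw [trdeg_eq_finrank_grad_algebraMap]
  have h1 := le_finrank_span_gradι U
  have h2 : Submodule.span (FractionRing (SymmetricAlgebra K h)) (gradι K h '' U) ≤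
      Submodule.span (FractionRing (SymmetricAlgebra K h)) ((fun f => grad K h (algebraMap _ _ f)) ''
        (Algebra.adjoin K (SymmetricAlgebra.ι K h '' (U : Set h)) : Set (SymmetricAlgebra K h))) := by
    apply Submodule.span_mono
    rintro _ ⟨u, hu, rfl⟩
    exact ⟨_, Algebra.subset_adjoin ⟨u, hu, rfl⟩, rfl⟩
  have h3 := Submodule.finrank_mono h2
  have h4 := D.finrank_h
  have h5 := D.index_h_le_one
  have h6 : finrank K h + index K h ≤ 2 * finrank (FractionRing (SymmetricAlgebra K h))
      (Submodule.span (FractionRing (SymmetricAlgebra K h)) ((fun f => grad K h (algebraMap _ _ f)) ''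
        (Algebra.adjoin K (SymmetricAlgebra.ι K h '' (U : Set h)) : Set (SymmetricAlgebra K h)))) := by
    omega
  exact_mod_cast h6

theorem mem_polynomialPart {A : Subalgebra K (SymmetricAlgebra K D.b)} {p : SymmetricAlgebra K g} :
    p ∈ D.polynomialPart A ↔
      ∃ f ∈ A ⊔ Algebra.adjoin K {SymmetricAlgebra.ι K D.b ⟨D.e, D.e_mem_b⟩},
        D.tilde f = algebraMap _ _ p := Iff.rfl

omit [FiniteDimensional K g] in
theorem ι_e_mem_adjoin (A : Subalgebra K (SymmetricAlgebra K D.b)) :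
    SymmetricAlgebra.ι K D.b ⟨D.e, D.e_mem_b⟩ ∈
      A ⊔ Algebra.adjoin K {SymmetricAlgebra.ι K D.b ⟨D.e, D.e_mem_b⟩} :=
  (le_sup_right : _ ≤ A ⊔ _) (Algebra.subset_adjoin rfl)

theorem ι_e_mem_polynomialPart (A : Subalgebra K (SymmetricAlgebra K D.b)) :
    SymmetricAlgebra.ι K g D.e ∈ D.polynomialPart A :=
  D.mem_polynomialPart.mpr ⟨_, D.ι_e_mem_adjoin A, D.tilde_e⟩

/-- Adjoining `e` to `A` makes this possible: since `ẽ = e`, multiplying by a power of `e` stays in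
the image and clears denominators. -/
theorem exists_mem_polynomialPart (A : Subalgebra K (SymmetricAlgebra K D.b))
    {f : SymmetricAlgebra K D.b} (hf : f ∈ A) :
    ∃ N, ∃ p ∈ D.polynomialPart A, D.tilde f = algebraMap _ _ p * (D.fracE ^ N)⁻¹ := by
  obtain ⟨N, p, hp, -⟩ := D.exists_numerator f
  refine ⟨N, p, D.mem_polynomialPart.mpr ⟨f * SymmetricAlgebra.ι K D.b ⟨D.e, D.e_mem_b⟩ ^ N,
    mul_mem ((le_sup_left : A ≤ A ⊔ _) hf) (pow_mem (D.ι_e_mem_adjoin A) N), ?_⟩, ?_⟩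
  · rw [map_mul, map_pow, D.tilde_e, hp]
  · rw [← hp, mul_inv_cancel_right₀ (pow_ne_zero _ D.fracE_ne_zero)]

theorem polynomialPart_commutative [CharZero K] (he : D.e ∈ LieAlgebra.center K g)
    {A : Subalgebra K (SymmetricAlgebra K D.b)}
    (hA : ∀ f₁ ∈ A, ∀ f₂ ∈ A, poissonBracket f₁ f₂ = 0) :
    ∀ p₁ ∈ D.polynomialPart A, ∀ p₂ ∈ D.polynomialPart A, poissonBracket p₁ p₂ = 0 := by
  -- Centrality of `e` in `S(b)` is read off in `Frac S(g)`, where `ẽ = e` commutes with every `f̃`.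
  have heb : ∀ f : SymmetricAlgebra K D.b,
      poissonBracket f (SymmetricAlgebra.ι K D.b ⟨D.e, D.e_mem_b⟩) = 0 := by
    intro f
    apply D.tilde_injective
    rw [D.tilde_poissonBracket he, D.tilde_e, fracPoissonBracket_swap, fracE,
      fracPoissonBracket_eq, fracPoissonDerivation_ι, D.fracHamiltonian_tilde he D.e_mem, neg_zero,
      map_zero]
  have hcomm : ∀ f₁ ∈ A ⊔ Algebra.adjoin K {SymmetricAlgebra.ι K D.b ⟨D.e, D.e_mem_b⟩},
      ∀ f₂ ∈ A ⊔ Algebra.adjoin K {SymmetricAlgebra.ι K D.b ⟨D.e, D.e_mem_b⟩},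
        poissonBracket f₁ f₂ = 0 := by
    rw [← Algebra.adjoin_eq A, ← Algebra.adjoin_union]
    apply poissonBracket_adjoin
    rintro a (ha | rfl) b (hb | rfl)
    · exact hA a ha b hb
    · exact heb a
    · rw [poissonBracket_swap, heb, neg_zero]
    · exact heb _
  intro p₁ hp₁ p₂ hp₂
  obtain ⟨f₁, hf₁, h₁⟩ := D.mem_polynomialPart.mp hp₁
  obtain ⟨f₂, hf₂, h₂⟩ := D.mem_polynomialPart.mp hp₂
  apply IsFractionRing.injective (SymmetricAlgebra K g) (FractionRing (SymmetricAlgebra K g))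
  rw [algebraMap_poissonBracket, ← h₁, ← h₂, ← D.tilde_poissonBracket he, hcomm f₁ hf₁ f₂ hf₂,
    map_zero, map_zero]

theorem poissonBracket_sup_eq_zero [CharZero K] (he : D.e ∈ LieAlgebra.center K g)
    {A : Subalgebra K (SymmetricAlgebra K D.b)}
    (hA : ∀ f₁ ∈ A, ∀ f₂ ∈ A, poissonBracket f₁ f₂ = 0)
    {B : Subalgebra K (SymmetricAlgebra K h)}
    (hB : ∀ f₁ ∈ B, ∀ f₂ ∈ B, poissonBracket f₁ f₂ = 0) :
    ∀ p₁ ∈ D.polynomialPart A ⊔ B.map (symInclusion h),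
      ∀ p₂ ∈ D.polynomialPart A ⊔ B.map (symInclusion h), poissonBracket p₁ p₂ = 0 := by
  have hAB : ∀ p ∈ D.polynomialPart A, ∀ f, poissonBracket p (symInclusion h f) = 0 :=
    fun p hp f => poissonBracket_eq_zero_of_forall_ι (D.polynomialPart_le_ann he A hp)
      (symInclusion_mem_adjoin h f)
  rw [← Algebra.adjoin_eq (D.polynomialPart A), ← Algebra.adjoin_eq (B.map (symInclusion h)),
    ← Algebra.adjoin_union]
  apply poissonBracket_adjoin
  rintro a (ha | ⟨a, ha, rfl⟩) b (hb | ⟨b, hb, rfl⟩)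
  · exact D.polynomialPart_commutative he hA a ha b hb
  · exact hAB a ha b
  · rw [poissonBracket_swap]
    exact neg_eq_zero.mpr (hAB b hb a)
  · exact (symInclusion_poissonBracket h a b).symm.trans (by rw [hB a ha b hb, map_zero])

/-- The differentials of `β̃` and of `h` together span everything. -/
theorem span_grad_tilde_sup :
    Submodule.span (FractionRing (SymmetricAlgebra K g))
        (Set.range fun β => grad K g (D.tilde (SymmetricAlgebra.ι K D.b β))) ⊔
      Submodule.span (FractionRing (SymmetricAlgebra K g)) (gradι K g '' (h.toSubmodule : Set g)) =
        ⊤ := by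
  set P := Submodule.span (FractionRing (SymmetricAlgebra K g))
    (Set.range fun β => grad K g (D.tilde (SymmetricAlgebra.ι K D.b β)))
  set Q := Submodule.span (FractionRing (SymmetricAlgebra K g))
    (gradι K g '' (h.toSubmodule : Set g))
  have hι : ∀ η ∈ h, gradι K g η ∈ Q := fun η hη => Submodule.subset_span ⟨η, hη, rfl⟩
  -- The quadratic correction is a rational function of elements of `h`, so `f̃_β` and `β` have the
  -- same differential modulo `Q`.
  have hquad : ∀ β : D.b, grad K g ((2⁻¹ : K) • (algebraMap _ _ (D.quad β) * D.fracE⁻¹)) ∈ Q := by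
    intro β
    have h1 : grad K g (algebraMap _ _ (D.quad β)) ∈ Q := by
      apply grad_mem_of_mem_adjoin
      rw [quad_apply]
      refine neg_mem (sum_mem fun i _ => mul_mem ?_ ?_)
      · exact Algebra.subset_adjoin ⟨_, D.V_le (Subtype.prop _), rfl⟩
      · exact Algebra.subset_adjoin ⟨_, D.V_le (Subtype.prop _), rfl⟩
    have h2 : grad K g D.fracE ∈ Q := hι _ D.e_mem
    rw [Derivation.map_smul, Derivation.leibniz, Derivation.leibniz_inv,
      ← algebraMap_smul (FractionRing (SymmetricAlgebra K g))]
    exact Submodule.smul_mem _ _ (Submodule.add_mem _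
      (Submodule.smul_mem _ _ (Submodule.smul_mem _ _ h2)) (Submodule.smul_mem _ _ h1))
  rw [eq_top_iff, ← span_grad_ι, Submodule.span_le]
  rintro _ ⟨w, rfl⟩
  obtain ⟨β, hβ, v, hv, rfl⟩ : ∃ β ∈ D.b.toSubmodule, ∃ v ∈ D.V, β + v = w := by
    rw [← Submodule.mem_sup, D.isCompl_b_V.sup_eq_top]
    exact Submodule.mem_top
  have h1 : grad K g (D.tilde (SymmetricAlgebra.ι K D.b ⟨β, hβ⟩)) ∈ P :=
    Submodule.subset_span ⟨_, rfl⟩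
  have h2 := D.tilde_ι_eq ⟨β, hβ⟩
  rw [← sub_eq_iff_eq_add] at h2
  change grad K g (algebraMap _ _ (SymmetricAlgebra.ι K g (β + v))) ∈ P ⊔ Q
  rw [map_add, map_add, map_add]
  refine Submodule.add_mem _ ?_ ((le_sup_right : Q ≤ P ⊔ Q) (hι v (D.V_le hv)))
  change grad K g (algebraMap _ _ (SymmetricAlgebra.ι K g ((⟨β, hβ⟩ : D.b) : g))) ∈ P ⊔ Q
  rw [← h2, map_sub]
  exact Submodule.sub_mem _ ((le_sup_left : P ≤ P ⊔ Q) h1)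
    ((le_sup_right : Q ≤ P ⊔ Q) (hquad _))

theorem grad_tilde_mem (f : SymmetricAlgebra K D.b) : grad K g (D.tilde f) ∈
    Submodule.span (FractionRing (SymmetricAlgebra K g))
      (Set.range fun β => grad K g (D.tilde (SymmetricAlgebra.ι K D.b β))) := by
  induction f using SymmetricAlgebra.induction with
  | algebraMap r =>
    rw [AlgHom.commutes, Derivation.map_algebraMap]
    exact Submodule.zero_mem _
  | ι β => exact Submodule.subset_span ⟨β, rfl⟩
  | mul a b ha hb =>
    rw [map_mul, Derivation.leibniz]
    exact Submodule.add_mem _ (Submodule.smul_mem _ _ hb) (Submodule.smul_mem _ _ ha)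
  | add a b ha hb =>
    rw [map_add, map_add]
    exact Submodule.add_mem _ ha hb

theorem grad_tilde_mem_span (A : Subalgebra K (SymmetricAlgebra K D.b))
    {C : Subalgebra K (SymmetricAlgebra K g)} (hC : D.polynomialPart A ≤ C)
    {f : SymmetricAlgebra K D.b} (hf : f ∈ A) :
    grad K g (D.tilde f) ∈ Submodule.span (FractionRing (SymmetricAlgebra K g))
      ((fun p => grad K g (algebraMap _ _ p)) '' (C : Set (SymmetricAlgebra K g))) := by
  obtain ⟨N, p, hp, hfp⟩ := D.exists_mem_polynomialPart A hf
  have hmem : ∀ p ∈ D.polynomialPart A, grad K g (algebraMap _ _ p) ∈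
      Submodule.span (FractionRing (SymmetricAlgebra K g))
        ((fun p => grad K g (algebraMap _ _ p)) '' (C : Set (SymmetricAlgebra K g))) := fun p hp =>
    Submodule.subset_span ⟨p, hC hp, rfl⟩
  have hE : grad K g (algebraMap _ _ (SymmetricAlgebra.ι K g D.e ^ N)) ∈ _ :=
    hmem _ (pow_mem (D.ι_e_mem_polynomialPart A) N)
  rw [hfp, fracE, ← map_pow, Derivation.leibniz, Derivation.leibniz_inv]
  exact Submodule.add_mem _ (Submodule.smul_mem _ _ (Submodule.smul_mem _ _ hE))
    (Submodule.smul_mem _ _ (hmem p hp))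

theorem finrank_span_grad_tilde_le : finrank (FractionRing (SymmetricAlgebra K g))
      (Submodule.span (FractionRing (SymmetricAlgebra K g))
        (Set.range fun β => grad K g (D.tilde (SymmetricAlgebra.ι K D.b β)))) ≤ finrank K D.b := by
  let δ : D.b →ₗ[K] (Fin (finrank K g) → FractionRing (SymmetricAlgebra K g)) :=
    (grad K g : FractionRing (SymmetricAlgebra K g) →ₗ[K] _) ∘ₗ D.tilde.toLinearMap ∘ₗ
      SymmetricAlgebra.ι K D.b
  have hδ : (fun β => grad K g (D.tilde (SymmetricAlgebra.ι K D.b β))) = δ := by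
    ext1 β
    rfl
  rw [hδ]
  exact finrank_span_range_le δ

/-- The 1 bounds the overlap of the spans of the `d f̃_β` and of `d h`: `dim b + (2m + 1) - dim g =
1`. -/
theorem trdeg_add_le [CharZero K] (A : Subalgebra K (SymmetricAlgebra K D.b))
    (B : Subalgebra K (SymmetricAlgebra K h)) :
    ∃ a b c : ℕ, Algebra.trdeg K A = a ∧ Algebra.trdeg K B = b ∧
      Algebra.trdeg K ↥(D.polynomialPart A ⊔ B.map (symInclusion h)) = c ∧ a + b ≤ c + 1 := by
  have hA : Algebra.trdeg K A = Algebra.trdeg K (A.map D.tilde) :=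
    (A.equivMapOfInjective D.tilde D.tilde_injective).trdeg_eq
  have hB : Algebra.trdeg K B = Algebra.trdeg K (B.map (symInclusion h)) :=
    (B.equivMapOfInjective _ (symInclusion_injective h)).trdeg_eq
  rw [trdeg_eq_finrank_grad] at hA
  rw [trdeg_eq_finrank_grad_algebraMap (B.map (symInclusion h))] at hB
  generalize hCdef : D.polynomialPart A ⊔ B.map (symInclusion h) = C
  have hAC : D.polynomialPart A ≤ C := hCdef ▸ le_sup_left
  have hBC : B.map (symInclusion h) ≤ C := hCdef ▸ le_sup_right
  refine ⟨_, _, _, hA, hB, trdeg_eq_finrank_grad_algebraMap C, ?_⟩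
  have h1 : finrank (FractionRing (SymmetricAlgebra K g))
      (Submodule.span (FractionRing (SymmetricAlgebra K g))
        (Set.range fun β => grad K g (D.tilde (SymmetricAlgebra.ι K D.b β)))) ≤ finrank K D.b :=
    D.finrank_span_grad_tilde_le
  have h2 : finrank (FractionRing (SymmetricAlgebra K g))
      (Submodule.span (FractionRing (SymmetricAlgebra K g))
        (gradι K g '' (h.toSubmodule : Set g))) ≤ finrank K h :=
    finrank_span_gradι_le h.toSubmodule
  have h3 := D.finrank_h
  have h4 := D.finrank_b_add
  have h5 := finrank_add_finrank_le_of_sup_eq_top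
    (P := Submodule.span (FractionRing (SymmetricAlgebra K g))
      (grad K g '' (A.map D.tilde : Set (FractionRing (SymmetricAlgebra K g)))))
    (Q := Submodule.span (FractionRing (SymmetricAlgebra K g))
      ((fun f => grad K g (algebraMap _ _ f)) ''
        (B.map (symInclusion h) : Set (SymmetricAlgebra K g))))
    (C := Submodule.span (FractionRing (SymmetricAlgebra K g))
      ((fun f => grad K g (algebraMap _ _ f)) '' (C : Set (SymmetricAlgebra K g))))
    ?_ ?_ ?_ ?_ D.span_grad_tilde_sup
  · rw [finrank_fin_fun] at h5
    omega
  · rw [Submodule.span_le]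
    rintro _ ⟨_, ⟨f, -, rfl⟩, rfl⟩
    exact D.grad_tilde_mem f
  · rw [Submodule.span_le]
    rintro _ ⟨_, ⟨f, -, rfl⟩, rfl⟩
    exact grad_mem_of_mem_adjoin (symInclusion_mem_adjoin h f)
  · rw [Submodule.span_le]
    rintro _ ⟨_, ⟨f, hf, rfl⟩, rfl⟩
    exact D.grad_tilde_mem_span A hAC hf
  · exact Submodule.span_mono (Set.image_mono hBC)

theorem isCompleteCommutative_sup [CharZero K] (he : D.e ∈ LieAlgebra.center K g)
    {A : Subalgebra K (SymmetricAlgebra K D.b)} (hA : IsCompleteCommutative A)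
    {B : Subalgebra K (SymmetricAlgebra K h)} (hB : IsCompleteCommutative B) :
    IsCompleteCommutative (D.polynomialPart A ⊔ B.map (symInclusion h)) := by
  have hcomm := D.poissonBracket_sup_eq_zero he hA.1 hB.1
  refine ⟨hcomm, le_antisymm (two_mul_trdeg_le _ hcomm) ?_⟩
  obtain ⟨a, b, c, ha, hb, hc, habc⟩ := D.trdeg_add_le A B
  have hA' := hA.2
  have hB' := hB.2
  rw [ha] at hA'
  rw [hb] at hB'
  rw [hc]
  norm_cast at hA' hB' ⊢
  have h1 := D.index_le_index_b
  have h2 := D.one_le_index_h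
  have h3 := D.finrank_h
  have h4 := D.finrank_b_add
  -- `2c ≥ 2a + 2b - 2 = dim b + ind b + dim h + ind h - 2`, which is at least `dim b + ind g + (2m
  -- + 1) + 1 - 2 = dim g + ind g`.
  omega

end HeisenbergSplitting

end MF

end

theorem proposition6 {K : Type*} [Field K] [CharZero K] {g : Type*} [LieRing g] [LieAlgebra K g]
    [FiniteDimensional K g] (h : LieIdeal K g) (m : ℕ) (D : MF.HeisenbergSplitting h m)
    (hZ : (LieAlgebra.center K h).toSubmodule.map h.toSubmodule.subtype =
      (LieAlgebra.center K g).toSubmodule) :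
    ((∃ A : Subalgebra K (SymmetricAlgebra K D.b), MF.IsCompleteCommutative A) →
      ∃ C : Subalgebra K (SymmetricAlgebra K g), MF.IsCompleteCommutative C) ∧
    (Function.Injective D.tilde ∧
      (∀ f₁ f₂ : SymmetricAlgebra K D.b,
        D.tilde (MF.poissonBracket f₁ f₂) = MF.fracPoissonBracket (D.tilde f₁) (D.tilde f₂)) ∧
      ∀ f : SymmetricAlgebra K D.b, D.tilde f ∈ MF.annFrac h) ∧
    ∀ A : Subalgebra K (SymmetricAlgebra K D.b), MF.IsCompleteCommutative A →
      D.polynomialPart A ≤ MF.ann h ∧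
      ∀ B : Subalgebra K (SymmetricAlgebra K h), MF.IsCompleteCommutative B →
        MF.IsCompleteCommutative (D.polynomialPart A ⊔ B.map (MF.symInclusion h)) := by
  have he := D.e_central hZ
  refine ⟨fun ⟨A, hA⟩ => ?_, ⟨D.tilde_injective, D.tilde_poissonBracket he, D.tilde_mem_annFrac he⟩,
    fun A hA => ⟨D.polynomialPart_le_ann he A, fun B hB => D.isCompleteCommutative_sup he hA hB⟩⟩
  obtain ⟨B, hB⟩ := D.exists_isCompleteCommutative_h
  exact ⟨_, D.isCompleteCommutative_sup he hA hB⟩
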